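/- Setting. A bipartite load balancing system has $N$ servers, finitely many ports, and buffer size $b$ (the job in service is counted). Jobs arrive at port $\ell$ as a Poisson process of rate $\lambda_\ell$ and may only be sent to the (nonempty) set of servers connected to $\ell$. There are $M$ server types; a server of type $m$ serves first-come-first-served with exponential service times of rate $\mu_m$, where $\mu_1>\dots>\mu_M>0$; all arrivals and service times are independent. A job routed to a server that already holds $b$ jobs is blocked and lost. JFSQ sends an arrival to a connected server with the shortest queue, preferring the largest service rate among these and breaking remaining ties uniformly at random. JFIQ sends it to a connected idle server with the largest service rate (ties broken uniformly at random), or to a uniformly random connected server if no connected server is idle. Consider a sequence of such systems $G_N$ whose number of servers $N$ tends to infinity (along sizes for which all $N\alpha_m$ are integers), with fixed rates $\mu_m$ and fixed fractions $\alpha_m>0$, $\sum_m\alpha_m=1$, so that exactly $N\alpha_m$ servers have type $m$. Let $\lambda_\Sigma=\sum_\ell\lambda_\ell$ and $\lambda=\lambda_N=\lambda_\Sigma/N$. Let $K$, the same for all $N$, be the least index with $N\sum_{m\le K}\mu_m\alpha_m>\lambda_\Sigma$; write $\lambda_\Sigma=N\sum_{m\le K}\mu_m\alpha_m(1-\beta_N)$,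 and assume that $\lambda_N$ stays bounded away from $0$. Put $\hat\beta_N=\beta_N\sum_{m\le K}\alpha_m$, $\tau_{1K}=\mu_1/\mu_K$ and $$C^*=C^*_N=\sum_{m<K}\alpha_m+\frac{\lambda-\sum_{m<K}\mu_m\alpha_m}{\mu_K}.$$ For a set $I$ of servers let $D_I$ be the total arrival rate of the ports that are connected to no server of $I$. Suppose that $\epsilon_N=o(1)$ and $\epsilon_N=\omega(\ln N\cdot N^{-1/2})$, and that for all large $N$, writing $\epsilon=\epsilon_N$, $b=b_N$, $\hat\beta=\hat\beta_N$, we have $0<\epsilon\le\hat\beta/4$ and 1. (buffer size) $6\sqrt{\tau_{1K}}\le b\le\left\lfloor\left(\frac{\epsilon^2N}{1152\,\tau_{1K}\ln N}\right)^{1/5}\right\rfloor$; 2. (well-connectedness) for some $\tilde d_1\le\frac{\epsilon\mu_K}{12b^3}$ and $\tilde d_2\le\frac{\epsilon\mu_K}{2b}$: $D_I\le N\tilde d_1$ for every set $I$ of servers of types less than $K$ with $|I|\ge N\frac{\epsilon}{6b^2}$, and $D_I\le N\tilde d_2$ for every set $I$ of servers of types at most $K$ with $|I|\ge N\frac{\hat\beta}{2}$.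 Then both JFSQ and JFIQ are asymptotically optimal: each system has a unique stationary distribution, and in steady state, as $N\to\infty$, the mean response time of the admitted jobs converges to $C^*/\lambda$ (that is, its difference from $C^*_N/\lambda_N$ tends to $0$) and the probability that an arriving job is blocked tends to $0$. Moreover, for both policies the expected queueing delay (waiting time before service) of the admitted jobs converges to $0$. -/

import Mathlib

open Filter Topology MeasureTheory ProbabilityTheory

namespace LoadBalancing

/-- The two routing policies: Join-the-Fastest-of-the-Shortest-Queues and
Join-the-Fastest-of-the-Idle-Queues. -/
inductive Policy where
  | JFSQ
  | JFIQ

/-- A bipartite load balancing system whose servers have types in `Fin M`: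
`numServers` servers, `numPorts` ports, a common buffer size (counting the job in service),
the set `nbrs l` of servers connected to port `l`, the type of each server, and the rate of
the Poisson arrivals at each port. -/
structure System (M : ℕ) where
  numServers : ℕ
  numPorts : ℕ
  buffer : ℕ
  nbrs : Fin numPorts → Finset (Fin numServers)
  type : Fin numServers → Fin M
  arrival : Fin numPorts → ℝ
  arrival_nonneg : ∀ l, 0 ≤ arrival l
  nbrs_nonempty : ∀ l, (nbrs l).Nonempty

namespace System

variable {M : ℕ} (S : System M)

/-- A state: the queue lengths of all servers. -/
abbrev State : Type := Fin S.numServers → Fin (S.buffer + 1)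

/-- The total arrival rate `λ_Σ`. -/
def totalRate : ℝ := ∑ l, S.arrival l

/-- The normalized arrival rate `λ = λ_Σ / N`. -/
noncomputable def normRate : ℝ := S.totalRate / S.numServers

/-- The servers of `A` with the largest service rate. -/
noncomputable def fastest (μ : Fin M → ℝ) (A : Finset (Fin S.numServers)) :
    Finset (Fin S.numServers) :=
  open Classical in A.filter fun r => ∀ s ∈ A, μ (S.type s) ≤ μ (S.type r)

/-- The servers connected to port `l` with the shortest queue. -/
noncomputable def shortest (q : S.State) (l : Fin S.numPorts) : Finset (Fin S.numServers) :=
  open Classical in (S.nbrs l).filter fun r => ∀ s ∈ S.nbrs l, q r ≤ q s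

/-- The idle servers connected to port `l`. -/
noncomputable def idle (q : S.State) (l : Fin S.numPorts) : Finset (Fin S.numServers) :=
  open Classical in (S.nbrs l).filter fun r => q r = 0

/-- The servers among which an arrival at port `l` in state `q` is routed, uniformly. -/
noncomputable def candidates (μ : Fin M → ℝ) (P : Policy) (q : S.State) (l : Fin S.numPorts) :
    Finset (Fin S.numServers) :=
  open Classical in
  match P with
  | Policy.JFSQ => S.fastest μ (S.shortest q l)
  | Policy.JFIQ => if (S.idle q l).Nonempty then S.fastest μ (S.idle q l) else S.nbrs l

/-- The probability that an arrival at port `l` in state `q` is routed to server `r`. -/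
noncomputable def routeProb (μ : Fin M → ℝ) (P : Policy) (q : S.State) (l : Fin S.numPorts)
    (r : Fin S.numServers) : ℝ :=
  open Classical in
  if r ∈ S.candidates μ P q l then 1 / ((S.candidates μ P q l).card : ℝ) else 0

/-- `q'` arises from `q` when one job joins the queue of server `r`
(which forces that `q r` is less than the buffer size). -/
def Joins (q q' : S.State) (r : Fin S.numServers) : Prop :=
  ∀ s, (q' s : ℕ) = if s = r then (q s : ℕ) + 1 else (q s : ℕ)

/-- The transition rate of the queue length Markov chain from `q` to `q'`: a job joins some
server on arrival (an arrival that is routed to a full server is lost), or the job in service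
at some server departs. -/
noncomputable def transRate (μ : Fin M → ℝ) (P : Policy) (q q' : S.State) : ℝ :=
  open Classical in
  (∑ r, if S.Joins q q' r then ∑ l, S.arrival l * S.routeProb μ P q l r else 0) +
    ∑ r, if S.Joins q' q r then μ (S.type r) else 0

/-- `p` is a stationary distribution of the queue length Markov chain (global balance). -/
def IsStationary (μ : Fin M → ℝ) (P : Policy) (p : S.State → ℝ) : Prop :=
  (∀ q, 0 ≤ p q) ∧ ∑ q, p q = 1 ∧
    ∀ q, p q * ∑ q', S.transRate μ P q q' = ∑ q', p q' * S.transRate μ P q' q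

/-- The steady-state probability that an arriving job is blocked, i.e. routed to a server
whose buffer is full. -/
noncomputable def blockingProb (μ : Fin M → ℝ) (P : Policy) (p : S.State → ℝ) : ℝ :=
  open Classical in
  (∑ q, p q * ∑ l, S.arrival l *
    ∑ r, if (q r : ℕ) = S.buffer then S.routeProb μ P q l r else 0) / S.totalRate

/-- The steady-state rate at which jobs arrive at port `l`, find the system in state `q`, and
are admitted to the queue of server `r`. -/
noncomputable def admitRate (μ : Fin M → ℝ) (P : Policy) (p : S.State → ℝ) (q : S.State)
    (l : Fin S.numPorts) (r : Fin S.numServers) : ℝ :=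
  open Classical in
  if (q r : ℕ) < S.buffer then p q * (S.arrival l * S.routeProb μ P q l r) else 0

end System

/-- The law of the sum of `k` independent exponential service times of rate `x`. Under
first-come-first-served service this is the law of the time that a job spends waiting when it
joins a server of rate `x` with `k` jobs present (the residual service time of the job in
service is again exponential of rate `x`). -/
noncomputable def waitLaw (x : ℝ) (k : ℕ) : Measure ℝ :=
  (Measure.pi fun _ : Fin k => expMeasure x).map fun y => ∑ i, y i

namespace System

variable {M : ℕ} (S : System M)

/-- The steady-state joint law of the waiting time and the service time of an admitted job:
given that it joins server `r` in state `q`, it waits for `q r` services, and then has its own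
service time, which is independent of the waiting time. -/
noncomputable def jobLaw (μ : Fin M → ℝ) (P : Policy) (p : S.State → ℝ) : Measure (ℝ × ℝ) :=
  ∑ q, ∑ l, ∑ r,
    ENNReal.ofReal (S.admitRate μ P p q l r / ∑ q', ∑ l', ∑ r', S.admitRate μ P p q' l' r') •
      (waitLaw (μ (S.type r)) (q r : ℕ)).prod (expMeasure (μ (S.type r)))

/-- The mean response time (waiting time plus service time) of an admitted job. -/
noncomputable def meanResponse (μ : Fin M → ℝ) (P : Policy) (p : S.State → ℝ) : ℝ :=
  ∫ z, (z.1 + z.2) ∂(S.jobLaw μ P p)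

/-- The expected queueing delay (waiting time) of an admitted job. -/
noncomputable def meanDelay (μ : Fin M → ℝ) (P : Policy) (p : S.State → ℝ) : ℝ :=
  ∫ z, z.1 ∂(S.jobLaw μ P p)

/-- `D_I`, the total arrival rate at the ports that are not connected to `I`. -/
noncomputable def disconnected (I : Finset (Fin S.numServers)) : ℝ :=
  open Classical in
  ∑ l, if Disjoint (S.nbrs l) I then S.arrival l else 0

end System

/-- The ratio `τ_{1K} = μ_1 / μ_K`. -/
noncomputable def tau {M : ℕ} (μ : Fin M → ℝ) (K : Fin M) : ℝ := μ ⟨0, K.pos⟩ / μ K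

/-- `β̂ = β ∑_{m ≤ K} α_m`. -/
noncomputable def betaHat {M : ℕ} (α : Fin M → ℝ) (K : Fin M) (β : ℝ) : ℝ :=
  β * ∑ m ∈ Finset.Iic K, α m

/-- `C^* = ∑_{m < K} α_m + (λ - ∑_{m < K} μ_m α_m) / μ_K`, where `x` stands for `λ`. -/
noncomputable def cStar {M : ℕ} (μ α : Fin M → ℝ) (K : Fin M) (x : ℝ) : ℝ :=
  ∑ m ∈ Finset.Iio K, α m + (x - ∑ m ∈ Finset.Iio K, μ m * α m) / μ K

/-- `K` is the least index with `λ_Σ < N ∑_{m ≤ K} μ_m α_m`. -/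
def IsCritical {M : ℕ} (S : System M) (μ α : Fin M → ℝ) (K : Fin M) : Prop :=
  IsLeast {k : Fin M | S.totalRate < S.numServers * ∑ m ∈ Finset.Iic k, μ m * α m} K

/-- The assumption on the buffer size, for the approximation parameter `ε ∈ (0, β̂ / 4]`. -/
def BufferAssumption {M : ℕ} (S : System M) (μ α : Fin M → ℝ) (K : Fin M) (β ε : ℝ) : Prop :=
  0 < ε ∧ ε ≤ betaHat α K β / 4 ∧
    6 * √(tau μ K) ≤ S.buffer ∧
    S.buffer ≤ ⌊(ε ^ 2 * S.numServers /
      (1152 * tau μ K * Real.log S.numServers)) ^ (1 / 5 : ℝ)⌋₊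

/-- The well-connectedness assumption. -/
def WellConnected {M : ℕ} (S : System M) (μ α : Fin M → ℝ) (K : Fin M) (β ε : ℝ) : Prop :=
  ∃ d₁ d₂ : ℝ,
    d₁ ≤ ε * μ K / (12 * (S.buffer : ℝ) ^ 3) ∧
    d₂ ≤ ε * μ K / (2 * (S.buffer : ℝ)) ∧
    (∀ I : Finset (Fin S.numServers), (∀ r ∈ I, S.type r < K) →
      S.numServers * (ε / (6 * (S.buffer : ℝ) ^ 2)) ≤ (I.card : ℝ) →
        S.disconnected I ≤ S.numServers * d₁) ∧
    (∀ I : Finset (Fin S.numServers), (∀ r ∈ I, S.type r ≤ K) →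
      S.numServers * (betaHat α K β / 2) ≤ (I.card : ℝ) →
        S.disconnected I ≤ S.numServers * d₂)

/-- Asymptotic optimality, in the response time, of the policy `P` along the sequence of
systems `G`: every system is stable (it has exactly one stationary distribution), and in steady
state the mean response time approaches `C^* / λ` and the blocking probability vanishes. -/
def AsymptoticallyOptimal {M : ℕ} (G : ℕ → System M) (μ α : Fin M → ℝ) (K : Fin M)
    (P : Policy) : Prop :=
  (∀ n, ∃! p : (G n).State → ℝ, (G n).IsStationary μ P p) ∧
    ∀ p : (n : ℕ) → (G n).State → ℝ, (∀ n, (G n).IsStationary μ P (p n)) →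
      Tendsto (fun n => (G n).meanResponse μ P (p n) -
        cStar μ α K (G n).normRate / (G n).normRate) atTop (𝓝 0) ∧
      Tendsto (fun n => (G n).blockingProb μ P (p n)) atTop (𝓝 0)

end LoadBalancing

/-!
The queue lengths form a finite continuous-time Markov chain, from every state of which the empty
state can be reached by departures; hence its stationary distribution exists and is unique
(`existsUnique_isStationary`). In steady state the generator of the chain has mean zero on every
function. Applied to quadratic functions of single queues, this is Little's law
(`meanResponse_eq`, `meanDelay_eq`), which expresses the response time and the delay through the
mean number of jobs, the mean number of waiting jobs and the rate of admission. It remains to show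
that, divided by `N`, these are `C^*`, `0` and `λ` up to `o(1)` (`error_bounds`).

Both policies send an arrival to a fastest connected idle server if there is one, and the argument
uses nothing else about them. By well-connectedness, almost all arrivals therefore join an idle
server of type less than `K`, respectively at most `K`, while enough of these are idle. Two Lyapunov
functions exploit this.

* An exponential of the number of idle servers of types less than `K` shows that this number
  exceeds `N ε / (3 b ^ 2)` with probability at most `N ^ (-3)` (`prob_idleFast_le`).
* Let `W` and `Z` be the numbers of busy servers and of waiting jobs at the servers of types at most
  `K`, and consider `Z + (W - N C^*)⁺`. Where `W` exceeds `N C^*` by a multiple of `N ε`, the busy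
  servers, among which are nearly all those of types less than `K`, work faster than jobs arrive,
  and `W + Z` decreases. Where it does not, a fraction of at least `β̂ / 2` of the servers is idle
  and of type at most `K`, since `ε ≤ β̂ / 4`; then almost no arrival has to wait, and `Z`
  decreases. After smoothing the positive part, so that the kink costs only lower-order terms, a
  quadratic function yields that the mean excess of this quantity over `N ε` is `O(b / ε)`
  (`drift_excess`, `mean_excess_le`).

Consequently `W + Z` is at most `N (C^* + 3 ε)` in the mean, and the probability that fewer than
`N β̂ / 2` servers of types at most `K` are idle is `o(1 / b)` (`prob_few_idle_le`). So almost no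
arrival misses the idle servers of types at most `K`, even after multiplication by `b`
(`mean_missing_le`), which bounds the blocking probability and the number of jobs at servers of
types greater than `K`. The matching lower bound holds because `N C^*` is the least number of busy
servers that can serve the arriving work (`le_mean_busyAll`).
-/

namespace LoadBalancing

namespace System

variable {M : ℕ} (S : System M) (μ : Fin M → ℝ) (P : Policy)

/-! ### The generator of the queue length chain -/

/-- The state after a job joins server `r`; a full server stays full, so that a lost arrival is a
transition from the state to itself. -/
def up (q : S.State) (r : Fin S.numServers) : S.State :=
  Function.update q r ⟨min ((q r : ℕ) + 1) S.buffer, by omega⟩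

/-- The state after a departure from server `r`; an idle server stays idle. -/
def down (q : S.State) (r : Fin S.numServers) : S.State :=
  Function.update q r ⟨(q r : ℕ) - 1, by omega⟩

/-- The rate at which arrivals, blocked or not, are routed to server `r` in state `q`. -/
noncomputable def joinRate (q : S.State) (r : Fin S.numServers) : ℝ :=
  ∑ l, S.arrival l * S.routeProb μ P q l r

/-- The generator of the queue length chain. Blocked arrivals and idle servers contribute zero,
because `up` and `down` then fix the state. -/
noncomputable def gen (f : S.State → ℝ) (q : S.State) : ℝ :=
  ∑ r, S.joinRate μ P q r * (f (S.up q r) - f q) +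
    ∑ r, μ (S.type r) * (f (S.down q r) - f q)

variable {S μ P}

theorem joins_iff_up {q q' : S.State} {r : Fin S.numServers} :
    S.Joins q q' r ↔ (q r : ℕ) < S.buffer ∧ q' = S.up q r := by
  constructor
  · intro h
    have h1 := h r
    simp only [if_true] at h1
    have h2 := (q' r).is_lt
    refine ⟨by omega, funext fun s => Fin.ext ?_⟩
    by_cases hs : s = r
    · subst hs
      simp only [up, Function.update_self]
      omega
    · simpa [up, hs] using h s
  · rintro ⟨h, rfl⟩ s
    by_cases hs : s = r
    · subst hs
      simp only [up, Function.update_self, if_true]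
      omega
    · simp [up, hs]

theorem joins_iff_down {q q' : S.State} {r : Fin S.numServers} :
    S.Joins q' q r ↔ 0 < (q r : ℕ) ∧ q' = S.down q r := by
  constructor
  · intro h
    have h1 := h r
    simp only [if_true] at h1
    refine ⟨by omega, funext fun s => Fin.ext ?_⟩
    by_cases hs : s = r
    · subst hs
      simp only [down, Function.update_self]
      omega
    · simpa [down, hs] using (h s).symm
  · rintro ⟨h, rfl⟩ s
    by_cases hs : s = r
    · subst hs
      simp only [down, Function.update_self, if_true]
      omega
    · simp [down, hs]

theorem up_eq_self {q : S.State} {r : Fin S.numServers} (h : ¬(q r : ℕ) < S.buffer) :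
    S.up q r = q := by
  have := (q r).is_lt
  refine Function.update_eq_self_iff.2 (Fin.ext ?_)
  simp only
  omega

theorem down_eq_self {q : S.State} {r : Fin S.numServers} (h : ¬0 < (q r : ℕ)) :
    S.down q r = q := by
  refine Function.update_eq_self_iff.2 (Fin.ext ?_)
  simp only
  omega

theorem sum_transRate_mul (f : S.State → ℝ) (q : S.State) :
    ∑ q', S.transRate μ P q q' * (f q' - f q) = S.gen μ P f q := by
  classical
  simp only [transRate, add_mul, Finset.sum_add_distrib, Finset.sum_mul, gen]
  congr 1
  · rw [Finset.sum_comm]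
    refine Finset.sum_congr rfl fun r _ => ?_
    simp only [joins_iff_up]
    by_cases h : (q r : ℕ) < S.buffer
    · rw [Finset.sum_eq_single (S.up q r)]
      · simp [h, joinRate]
      · intro q' _ hq'
        simp [hq']
      · simp
    · simp [h, up_eq_self h]
  · rw [Finset.sum_comm]
    refine Finset.sum_congr rfl fun r _ => ?_
    simp only [joins_iff_down]
    by_cases h : 0 < (q r : ℕ)
    · rw [Finset.sum_eq_single (S.down q r)]
      · rw [if_pos ⟨h, rfl⟩]
      · intro q' _ hq'
        simp [hq']
      · simp
    · simp only [h, false_and, if_false, zero_mul, Finset.sum_const_zero, down_eq_self h, sub_self,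
        mul_zero]

/-- In steady state, the generator has mean zero. -/
theorem IsStationary.sum_gen {p : S.State → ℝ} (hp : S.IsStationary μ P p) (f : S.State → ℝ) :
    ∑ q, p q * S.gen μ P f q = 0 := by
  simp only [← sum_transRate_mul, Finset.mul_sum, mul_sub, Finset.sum_sub_distrib]
  rw [Finset.sum_comm, sub_eq_zero]
  refine Finset.sum_congr rfl fun q _ => ?_
  simp only [← mul_assoc, ← Finset.sum_mul, ← Finset.mul_sum]
  rw [hp.2.2 q]

theorem routeProb_nonneg (q : S.State) (l : Fin S.numPorts) (r : Fin S.numServers) :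
    0 ≤ S.routeProb μ P q l r := by
  unfold routeProb
  split_ifs <;> positivity

theorem joinRate_nonneg (q : S.State) (r : Fin S.numServers) : 0 ≤ S.joinRate μ P q r :=
  Finset.sum_nonneg fun l _ => mul_nonneg (S.arrival_nonneg l) (routeProb_nonneg q l r)

theorem transRate_nonneg (hμ : ∀ m, 0 < μ m) (q q' : S.State) : 0 ≤ S.transRate μ P q q' := by
  unfold transRate
  refine add_nonneg (Finset.sum_nonneg fun r _ => ?_) (Finset.sum_nonneg fun r _ => ?_)
  · split_ifs
    · exact joinRate_nonneg q r
    · exact le_rfl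
  · split_ifs
    · exact (hμ _).le
    · exact le_rfl

theorem transRate_down_pos (hμ : ∀ m, 0 < μ m) {q : S.State} {r : Fin S.numServers}
    (h : 0 < (q r : ℕ)) : 0 < S.transRate μ P q (S.down q r) := by
  classical
  unfold transRate
  refine add_pos_of_nonneg_of_pos (Finset.sum_nonneg fun s _ => ?_)
    (Finset.sum_pos' (fun s _ => ?_) ⟨r, Finset.mem_univ r, ?_⟩)
  · split_ifs
    · exact joinRate_nonneg q s
    · exact le_rfl
  · split_ifs
    · exact (hμ _).le
    · exact le_rfl
  · rw [if_pos (joins_iff_down.2 ⟨h, rfl⟩)]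
    exact hμ _

end System

/-! ### Existence and uniqueness of the stationary distribution -/

section Balance

variable {σ : Type*} [Fintype σ] {R : σ → σ → ℝ}

/-- The linear map that sends a signed measure to its net inflow under the rates `R`; its kernel
consists of the solutions of global balance. -/
noncomputable def netFlow (R : σ → σ → ℝ) : (σ → ℝ) →ₗ[ℝ] (σ → ℝ) where
  toFun v q := ∑ q', v q' * R q' q - v q * ∑ q', R q q'
  map_add' v w := by
    ext q
    simp only [Pi.add_apply, add_mul, Finset.sum_add_distrib]
    ring
  map_smul' c v := by
    ext q
    simp only [Pi.smul_apply, smul_eq_mul, mul_assoc, ← Finset.mul_sum, RingHom.id_apply]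
    ring

theorem sum_netFlow (R : σ → σ → ℝ) (v : σ → ℝ) : ∑ q, netFlow R v q = 0 := by
  simp only [netFlow, LinearMap.coe_mk, AddHom.coe_mk, Finset.sum_sub_distrib, Finset.mul_sum]
  rw [Finset.sum_comm, sub_self]

/-- Total mass is conserved, so the net flow is not surjective, hence not injective. -/
theorem exists_netFlow_eq_zero [Nonempty σ] (R : σ → σ → ℝ) :
    ∃ v : σ → ℝ, v ≠ 0 ∧ netFlow R v = 0 := by
  by_contra! h
  have hinj : Function.Injective (netFlow R) := by
    rw [← LinearMap.ker_eq_bot, LinearMap.ker_eq_bot']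
    intro v hv
    by_contra hne
    exact h v hne hv
  obtain ⟨v, hv⟩ := (LinearMap.injective_iff_surjective.1 hinj) 1
  have h1 := sum_netFlow R v
  rw [hv] at h1
  simp at h1

/-- If a signed measure is balanced, then so is its absolute value: the triangle inequality gives
an inequality at each state, and conservation of mass makes all of them equalities. -/
theorem netFlow_abs_eq_zero (hR : ∀ q q', 0 ≤ R q q') {v : σ → ℝ} (hv : netFlow R v = 0) :
    netFlow R (fun q => |v q|) = 0 := by
  have hnn : ∀ q ∈ Finset.univ, 0 ≤ netFlow R (fun q => |v q|) q := by
    intro q _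
    have hq : ∑ q', v q' * R q' q = v q * ∑ q', R q q' := by
      have := congrFun hv q
      simpa [netFlow, sub_eq_zero] using this
    have h1 : |∑ q', v q' * R q' q| ≤ ∑ q', |v q'| * R q' q := by
      refine (Finset.abs_sum_le_sum_abs _ _).trans_eq (Finset.sum_congr rfl fun q' _ => ?_)
      rw [abs_mul, abs_of_nonneg (hR q' q)]
    rw [hq, abs_mul, abs_of_nonneg (Finset.sum_nonneg fun q' _ => hR q q')] at h1
    simpa [netFlow] using h1
  funext q
  exact (Finset.sum_eq_zero_iff_of_nonneg hnn).1 (sum_netFlow R _) q (Finset.mem_univ q)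

theorem pos_of_netFlow_eq_zero (hR : ∀ q q', 0 ≤ R q q') {v : σ → ℝ} (hv : netFlow R v = 0)
    (hnn : ∀ q, 0 ≤ v q) {q q' : σ} (hq : 0 < v q) (hqq : 0 < R q q') : 0 < v q' := by
  have h1 : ∑ s, v s * R s q' = v q' * ∑ s, R q' s := by
    have := congrFun hv q'
    simpa [netFlow, sub_eq_zero] using this
  have h2 : v q * R q q' ≤ ∑ s, v s * R s q' :=
    Finset.single_le_sum (f := fun s => v s * R s q')
      (fun s _ => mul_nonneg (hnn s) (hR s q')) (Finset.mem_univ q)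
  have h3 := mul_pos hq hqq
  refine lt_of_le_of_ne (hnn q') fun h => ?_
  rw [← h, zero_mul] at h1
  linarith

theorem sum_eq_zero_cancel {v : σ → ℝ} (hs : ∑ q, v q = 0)
    (h : (∀ q, 0 ≤ v q) ∨ ∀ q, v q ≤ 0) : v = 0 := by
  funext q
  rcases h with h | h
  · exact (Finset.sum_eq_zero_iff_of_nonneg fun q _ => h q).1 hs q (Finset.mem_univ q)
  · exact (Finset.sum_eq_zero_iff_of_nonpos fun q _ => h q).1 hs q (Finset.mem_univ q)

/-- A finite chain in which every nonzero nonnegative balanced measure charges one common state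
has exactly one stationary distribution. -/
theorem existsUnique_balanced [Nonempty σ] (hR : ∀ q q', 0 ≤ R q q') (o : σ)
    (ho : ∀ v : σ → ℝ, netFlow R v = 0 → (∀ q, 0 ≤ v q) → v ≠ 0 → 0 < v o) :
    ∃! p : σ → ℝ, (∀ q, 0 ≤ p q) ∧ ∑ q, p q = 1 ∧ netFlow R p = 0 := by
  obtain ⟨v, hv0, hv⟩ := exists_netFlow_eq_zero R
  have habs := netFlow_abs_eq_zero hR hv
  have hsum : 0 < ∑ q, |v q| := by
    obtain ⟨q, hq⟩ := Function.ne_iff.1 hv0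
    exact Finset.sum_pos' (fun q _ => abs_nonneg _) ⟨q, Finset.mem_univ q, abs_pos.2 hq⟩
  refine ⟨(∑ q, |v q|)⁻¹ • fun q => |v q|, ⟨fun q => ?_, ?_, ?_⟩, ?_⟩
  · simp only [Pi.smul_apply, smul_eq_mul]
    positivity
  · simp only [Pi.smul_apply, smul_eq_mul, ← Finset.mul_sum]
    exact inv_mul_cancel₀ hsum.ne'
  · rw [map_smul, habs, smul_zero]
  rintro p ⟨hp0, hp1, hp2⟩
  set p' : σ → ℝ := (∑ q, |v q|)⁻¹ • fun q => |v q| with hp'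
  have hp'1 : ∑ q, p' q = 1 := by
    simp only [hp', Pi.smul_apply, smul_eq_mul, ← Finset.mul_sum]
    exact inv_mul_cancel₀ hsum.ne'
  have hp'2 : netFlow R p' = 0 := by rw [hp', map_smul, habs, smul_zero]
  set d : σ → ℝ := p - p' with hd
  have hd0 : netFlow R d = 0 := by rw [hd, map_sub, hp2, hp'2, sub_zero]
  have hds : ∑ q, d q = 0 := by simp [hd, hp1, hp'1]
  have hda := netFlow_abs_eq_zero hR hd0
  rw [← sub_eq_zero]
  refine sum_eq_zero_cancel hds ?_
  -- The positive and the negative part of `d` are both balanced, and they cannot both charge `o`.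
  by_contra! hcon
  obtain ⟨⟨s, hs⟩, ⟨t, ht⟩⟩ := hcon
  change d s < 0 at hs
  change 0 < d t at ht
  have h1 := ho ((fun q => |d q|) + d) (by rw [map_add, hda, hd0, add_zero])
    (fun q => by
      have := neg_abs_le (d q)
      simp only [Pi.add_apply]
      linarith) (fun h => by
      have := congrFun h t
      simp only [Pi.add_apply, Pi.zero_apply, abs_of_pos ht] at this
      linarith)
  have h2 := ho ((fun q => |d q|) - d) (by rw [map_sub, hda, hd0, sub_zero])
    (fun q => by simpa using le_abs_self (d q)) (fun h => by
      have := congrFun h s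
      simp only [Pi.sub_apply, Pi.zero_apply, abs_of_neg hs] at this
      linarith)
  simp only [Pi.add_apply, Pi.sub_apply] at h1 h2
  rcases abs_cases (d o) with h | h <;> linarith

end Balance

namespace System

variable {M : ℕ} {S : System M} {μ : Fin M → ℝ} {P : Policy}

/-- From every state, the empty state is reached by departures alone. -/
theorem pos_at_zero (hμ : ∀ m, 0 < μ m) {v : S.State → ℝ} (hv : netFlow (S.transRate μ P) v = 0)
    (hnn : ∀ q, 0 ≤ v q) : ∀ (k : ℕ) (q : S.State), ∑ r, (q r : ℕ) = k → 0 < v q → 0 < v 0 := by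
  intro k
  induction k with
  | zero =>
    intro q hk hq
    have : q = 0 := by
      funext r
      have := (Finset.sum_eq_zero_iff.1 hk) r (Finset.mem_univ r)
      exact Fin.ext (by simpa using this)
    rwa [← this]
  | succ k ih =>
    intro q hk hq
    obtain ⟨r, -, hr⟩ : ∃ r ∈ Finset.univ, (q r : ℕ) ≠ 0 := by
      by_contra! h
      rw [Finset.sum_eq_zero h] at hk
      omega
    have hr' : 0 < (q r : ℕ) := Nat.pos_of_ne_zero hr
    refine ih (S.down q r) ?_
      (pos_of_netFlow_eq_zero (transRate_nonneg hμ) hv hnn hq (transRate_down_pos hμ hr'))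
    have h1 : ∑ s, (q s : ℕ) = (q r : ℕ) + ∑ s ∈ Finset.univ.erase r, (q s : ℕ) :=
      (Finset.add_sum_erase _ _ (Finset.mem_univ r)).symm
    have h2 : ∑ s, (S.down q r s : ℕ) =
        (S.down q r r : ℕ) + ∑ s ∈ Finset.univ.erase r, (S.down q r s : ℕ) :=
      (Finset.add_sum_erase _ _ (Finset.mem_univ r)).symm
    have h3 : ∑ s ∈ Finset.univ.erase r, (S.down q r s : ℕ) =
        ∑ s ∈ Finset.univ.erase r, (q s : ℕ) :=
      Finset.sum_congr rfl fun s hs => by simp [down, Finset.ne_of_mem_erase hs]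
    have h4 : (S.down q r r : ℕ) = (q r : ℕ) - 1 := by simp [down]
    omega

theorem existsUnique_isStationary (hμ : ∀ m, 0 < μ m) :
    ∃! p : S.State → ℝ, S.IsStationary μ P p := by
  have h := existsUnique_balanced (transRate_nonneg (S := S) (P := P) hμ) 0
    (fun v hv hnn hne => by
      obtain ⟨q, hq⟩ := Function.ne_iff.1 hne
      exact pos_at_zero hμ hv hnn _ q rfl (lt_of_le_of_ne (hnn q) (Ne.symm hq)))
  refine (existsUnique_congr fun p => ?_).1 h
  unfold IsStationary
  refine and_congr_right fun _ => and_congr_right fun _ => ?_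
  rw [funext_iff]
  refine forall_congr' fun q => ?_
  simp only [netFlow, LinearMap.coe_mk, AddHom.coe_mk, Pi.zero_apply, sub_eq_zero]
  exact eq_comm

end System

end LoadBalancing

namespace LoadBalancing

/-! ### Means of the service and waiting times -/

theorem integrable_id_expMeasure {x : ℝ} (hx : 0 < x) : Integrable (fun y => y) (expMeasure x) ∧
    ∫ y, y ∂expMeasure x = 1 / x := by
  have hmeas : Measurable (gammaPDF 1 x) := (measurable_gammaPDFReal 1 x).ennreal_ofReal
  have hfin : ∀ᵐ y ∂(volume : Measure ℝ), gammaPDF 1 x y < ⊤ :=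
    Filter.Eventually.of_forall fun y => ENNReal.ofReal_lt_top
  have hfun : (fun y : ℝ => (gammaPDF 1 x y).toReal • y) =
      (Set.Ioi (0 : ℝ)).indicator fun y => x * (y ^ ((2 : ℝ) - 1) * Real.exp (-(x * y))) := by
    funext y
    rw [gammaPDF, ENNReal.toReal_ofReal]
    · by_cases hy : 0 < y
      · rw [Set.indicator_of_mem (Set.mem_Ioi.2 hy), gammaPDFReal, if_pos hy.le]
        norm_num
        ring
      · rw [Set.indicator_of_notMem (by simpa using hy), gammaPDFReal]
        split_ifs with h
        · have : y = 0 := le_antisymm (not_lt.1 hy) h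
          simp [this]
        · simp
    · unfold gammaPDFReal
      split_ifs
      · norm_num
        positivity
      · exact le_rfl
  have hint : IntegrableOn (fun y : ℝ => y ^ ((2 : ℝ) - 1) * Real.exp (-(x * y))) (Set.Ioi 0) := by
    have := integrableOn_rpow_mul_exp_neg_mul_rpow (p := 1) (s := (2 : ℝ) - 1) (b := x)
      (by norm_num) one_pos hx
    simpa [Real.rpow_one] using this
  unfold expMeasure gammaMeasure
  constructor
  · rw [integrable_withDensity_iff_integrable_smul' hmeas hfin, hfun,
      integrable_indicator_iff measurableSet_Ioi]
    exact hint.const_mul x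
  · rw [integral_withDensity_eq_integral_toReal_smul hmeas hfin, hfun,
      integral_indicator measurableSet_Ioi, integral_const_mul,
      Real.integral_rpow_mul_exp_neg_mul_Ioi two_pos hx, Real.Gamma_two]
    norm_num
    field_simp

theorem isProbabilityMeasure_waitLaw {x : ℝ} (hx : 0 < x) (k : ℕ) :
    IsProbabilityMeasure (waitLaw x k) := by
  have := isProbabilityMeasure_expMeasure hx
  exact Measure.isProbabilityMeasure_map (by fun_prop)

theorem integrable_id_waitLaw {x : ℝ} (hx : 0 < x) (k : ℕ) :
    Integrable (fun y => y) (waitLaw x k) ∧ ∫ y, y ∂waitLaw x k = k / x := by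
  have := isProbabilityMeasure_expMeasure hx
  have hmeas : AEMeasurable (fun y : Fin k → ℝ => ∑ i, y i)
      (Measure.pi fun _ : Fin k => expMeasure x) := by fun_prop
  have hi : ∀ i : Fin k, Integrable (fun y : Fin k → ℝ => y i)
      (Measure.pi fun _ : Fin k => expMeasure x) := fun i =>
    integrable_comp_eval (μ := fun _ : Fin k => expMeasure x) (i := i) (f := fun y : ℝ => y)
      (integrable_id_expMeasure hx).1
  have hid : AEStronglyMeasurable (fun y : ℝ => y)
      ((Measure.pi fun _ : Fin k => expMeasure x).map fun y => ∑ i, y i) := aestronglyMeasurable_id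
  constructor
  · unfold waitLaw
    rw [integrable_map_measure hid hmeas]
    exact integrable_finsetSum _ fun i _ => hi i
  · unfold waitLaw
    rw [integral_map hmeas hid, integral_finsetSum _ fun i _ => hi i]
    simp_rw [integral_eval, (integrable_id_expMeasure hx).2]
    simp [div_eq_mul_inv]

/-- The expectation of `f` under the weights `p`. -/
noncomputable def mean {σ : Type*} [Fintype σ] (p f : σ → ℝ) : ℝ := ∑ q, p q * f q

section Mean

variable {σ : Type*} [Fintype σ] {p f g : σ → ℝ}

theorem mean_add : mean p (fun q => f q + g q) = mean p f + mean p g := by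
  simp [mean, mul_add, Finset.sum_add_distrib]

theorem mean_sub : mean p (fun q => f q - g q) = mean p f - mean p g := by
  simp [mean, mul_sub, Finset.sum_sub_distrib]

theorem mean_const_mul (c : ℝ) : mean p (fun q => c * f q) = c * mean p f := by
  simp only [mean, Finset.mul_sum]
  exact Finset.sum_congr rfl fun q _ => by ring

theorem mean_const (hp : ∑ q, p q = 1) (c : ℝ) : mean p (fun _ => c) = c := by
  simp [mean, ← Finset.sum_mul, hp]

theorem mean_mono (hp : ∀ q, 0 ≤ p q) (h : ∀ q, f q ≤ g q) : mean p f ≤ mean p g :=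
  Finset.sum_le_sum fun q _ => mul_le_mul_of_nonneg_left (h q) (hp q)

theorem mean_nonneg (hp : ∀ q, 0 ≤ p q) (h : ∀ q, 0 ≤ f q) : 0 ≤ mean p f :=
  Finset.sum_nonneg fun q _ => mul_nonneg (hp q) (h q)

end Mean

namespace System

variable {M : ℕ} {S : System M} {μ : Fin M → ℝ} {P : Policy} {p : S.State → ℝ}

/-! ### Little's law -/

/-- The rate at which jobs are admitted in state `q`. -/
noncomputable def admission (S : System M) (μ : Fin M → ℝ) (P : Policy) (q : S.State) : ℝ :=
  ∑ r, if (q r : ℕ) < S.buffer then S.joinRate μ P q r else 0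

theorem sum_update_sub (h : Fin S.numServers → ℕ → ℝ) (q : S.State) (r : Fin S.numServers)
    (x : Fin (S.buffer + 1)) :
    ∑ s, h s (Function.update q r x s) - ∑ s, h s (q s) = h r x - h r (q r) := by
  rw [← Finset.sum_sub_distrib, Finset.sum_eq_single r]
  · simp
  · intro s _ hs
    simp [hs]
  · simp

/-- The drift of a sum of functions of the individual queue lengths. -/
theorem gen_sum (h : Fin S.numServers → ℕ → ℝ) (q : S.State) :
    S.gen μ P (fun q => ∑ s, h s (q s)) q =
      ∑ r, S.joinRate μ P q r *
          (if (q r : ℕ) < S.buffer then h r ((q r : ℕ) + 1) - h r (q r) else 0) +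
        ∑ r, μ (S.type r) * (if 0 < (q r : ℕ) then h r ((q r : ℕ) - 1) - h r (q r) else 0) := by
  unfold gen
  congr 1 <;> refine Finset.sum_congr rfl fun r _ => ?_ <;> congr 1
  · split_ifs with hr
    · rw [up, sum_update_sub]
      congr 2
      simp only
      omega
    · rw [up_eq_self hr, sub_self]
  · split_ifs with hr
    · rw [down, sum_update_sub]
    · rw [down_eq_self hr, sub_self]

theorem mean_gen (hp : S.IsStationary μ P p) (f : S.State → ℝ) : mean p (S.gen μ P f) = 0 :=
  hp.sum_gen f

theorem mean_admission (hp : S.IsStationary μ P p) :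
    mean p (S.admission μ P) =
      mean p fun q => ∑ r, if 0 < (q r : ℕ) then μ (S.type r) else 0 := by
  rw [← sub_eq_zero, ← mean_sub]
  refine (congrArg (mean p) (funext fun q => ?_)).trans
    (mean_gen hp (fun q => ∑ s, ((q s : ℕ) : ℝ)))
  rw [gen_sum (fun _ k => (k : ℝ)), sub_eq_add_neg, ← Finset.sum_neg_distrib, admission]
  congr 1 <;> refine Finset.sum_congr rfl fun r _ => ?_
  · split_ifs
    · push_cast
      ring
    · simp
  · split_ifs with h
    · rw [Nat.cast_sub h]
      simp
    · simp

theorem mean_sum_admit_response (hμ : ∀ m, 0 < μ m) (hp : S.IsStationary μ P p) :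
    (mean p fun q => ∑ r, if (q r : ℕ) < S.buffer then
      S.joinRate μ P q r * (((q r : ℕ) + 1) / μ (S.type r)) else 0) =
      mean p fun q => ∑ r, ((q r : ℕ) : ℝ) := by
  rw [← sub_eq_zero, ← mean_sub]
  refine (congrArg (mean p) (funext fun q => ?_)).trans
    (mean_gen hp (fun q => ∑ s, ((q s : ℕ) : ℝ) * ((q s : ℕ) + 1) / 2 / μ (S.type s)))
  rw [gen_sum (fun s k => (k : ℝ) * (k + 1) / 2 / μ (S.type s)), sub_eq_add_neg,
    ← Finset.sum_neg_distrib]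
  congr 1 <;> refine Finset.sum_congr rfl fun r _ => ?_ <;> have := (hμ (S.type r)).ne'
  · split_ifs
    · push_cast
      field_simp
      ring
    · simp
  · split_ifs with h
    · rw [Nat.cast_sub h]
      push_cast
      field_simp
      ring
    · simp [Nat.eq_zero_of_not_pos h]

theorem mean_sum_admit_delay (hμ : ∀ m, 0 < μ m) (hp : S.IsStationary μ P p) :
    (mean p fun q => ∑ r, if (q r : ℕ) < S.buffer then
      S.joinRate μ P q r * (((q r : ℕ) : ℝ) / μ (S.type r)) else 0) =
      mean p fun q => ∑ r, (((q r : ℕ) - 1 : ℕ) : ℝ) := by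
  rw [← sub_eq_zero, ← mean_sub]
  refine (congrArg (mean p) (funext fun q => ?_)).trans
    (mean_gen hp (fun q => ∑ s, ((q s : ℕ) : ℝ) * ((q s : ℕ) - 1) / 2 / μ (S.type s)))
  rw [gen_sum (fun s k => (k : ℝ) * (k - 1) / 2 / μ (S.type s)), sub_eq_add_neg,
    ← Finset.sum_neg_distrib]
  congr 1 <;> refine Finset.sum_congr rfl fun r _ => ?_ <;> have := (hμ (S.type r)).ne'
  · split_ifs
    · push_cast
      field_simp
      ring
    · simp
  · split_ifs with h
    · rw [Nat.cast_sub h]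
      push_cast
      field_simp
      ring
    · simp [Nat.eq_zero_of_not_pos h]

theorem sum_admitRate_mul (g : S.State → Fin S.numServers → ℝ) :
    ∑ q, ∑ l, ∑ r, S.admitRate μ P p q l r * g q r =
      mean p fun q => ∑ r, if (q r : ℕ) < S.buffer then S.joinRate μ P q r * g q r else 0 := by
  unfold mean
  refine Finset.sum_congr rfl fun q _ => ?_
  rw [Finset.sum_comm, Finset.mul_sum]
  refine Finset.sum_congr rfl fun r _ => ?_
  by_cases h : (q r : ℕ) < S.buffer
  · simp only [admitRate, h, if_true, joinRate, Finset.mul_sum, Finset.sum_mul]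
    exact Finset.sum_congr rfl fun l _ => by ring
  · simp [admitRate, h]

theorem admitRate_nonneg (hp : S.IsStationary μ P p) (q : S.State) (l : Fin S.numPorts)
    (r : Fin S.numServers) : 0 ≤ S.admitRate μ P p q l r := by
  unfold admitRate
  split_ifs
  · exact mul_nonneg (hp.1 q) (mul_nonneg (S.arrival_nonneg l) (routeProb_nonneg q l r))
  · exact le_rfl

theorem integral_jobLaw (hp : S.IsStationary μ P p) {φ : ℝ × ℝ → ℝ}
    {g : S.State → Fin S.numServers → ℝ}
    (hφ : ∀ q r, Integrable φ
      ((waitLaw (μ (S.type r)) (q r : ℕ)).prod (expMeasure (μ (S.type r)))) ∧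
      ∫ z, φ z ∂((waitLaw (μ (S.type r)) (q r : ℕ)).prod (expMeasure (μ (S.type r)))) = g q r) :
    ∫ z, φ z ∂(S.jobLaw μ P p) =
      (mean p fun q => ∑ r, if (q r : ℕ) < S.buffer then S.joinRate μ P q r * g q r else 0) /
        mean p (S.admission μ P) := by
  have hA : ∑ q, ∑ l, ∑ r, S.admitRate μ P p q l r = mean p (S.admission μ P) := by
    have := sum_admitRate_mul (μ := μ) (P := P) (p := p) (S := S) fun _ _ => 1
    simp only [mul_one] at this
    exact this
  have hA0 : 0 ≤ mean p (S.admission μ P) := by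
    rw [← hA]
    exact Finset.sum_nonneg fun q _ => Finset.sum_nonneg fun l _ => Finset.sum_nonneg fun r _ =>
      admitRate_nonneg hp q l r
  have hi := fun q l r => (hφ q r).1.smul_measure (c := ENNReal.ofReal (S.admitRate μ P p q l r /
    ∑ q', ∑ l', ∑ r', S.admitRate μ P p q' l' r')) ENNReal.ofReal_ne_top
  unfold jobLaw
  rw [integral_finsetSum_measure fun q _ => integrable_finsetSum_measure.2 fun l _ =>
    integrable_finsetSum_measure.2 fun r _ => hi q l r, ← sum_admitRate_mul, Finset.sum_div]
  refine Finset.sum_congr rfl fun q _ => ?_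
  rw [integral_finsetSum_measure fun l _ => integrable_finsetSum_measure.2 fun r _ => hi q l r,
    Finset.sum_div]
  refine Finset.sum_congr rfl fun l _ => ?_
  rw [integral_finsetSum_measure fun r _ => hi q l r, Finset.sum_div]
  refine Finset.sum_congr rfl fun r _ => ?_
  rw [integral_smul_measure, (hφ q r).2, hA,
    ENNReal.toReal_ofReal (div_nonneg (admitRate_nonneg hp q l r) hA0), smul_eq_mul]
  ring

theorem meanDelay_eq (hμ : ∀ m, 0 < μ m) (hp : S.IsStationary μ P p) :
    S.meanDelay μ P p =
      (mean p fun q => ∑ r, (((q r : ℕ) - 1 : ℕ) : ℝ)) / mean p (S.admission μ P) := by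
  rw [← mean_sum_admit_delay hμ hp, meanDelay]
  refine integral_jobLaw hp fun q r => ?_
  have := isProbabilityMeasure_expMeasure (hμ (S.type r))
  have := isProbabilityMeasure_waitLaw (hμ (S.type r)) (q r)
  have hw := integrable_id_waitLaw (hμ (S.type r)) (q r)
  refine ⟨hw.1.comp_fst _, ?_⟩
  rw [integral_fun_fst (fun y => y), hw.2]
  simp

/-- Little's law. -/
theorem meanResponse_eq (hμ : ∀ m, 0 < μ m) (hp : S.IsStationary μ P p) :
    S.meanResponse μ P p =
      (mean p fun q => ∑ r, ((q r : ℕ) : ℝ)) / mean p (S.admission μ P) := by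
  rw [← mean_sum_admit_response hμ hp, meanResponse]
  refine integral_jobLaw hp fun q r => ?_
  have := isProbabilityMeasure_expMeasure (hμ (S.type r))
  have := isProbabilityMeasure_waitLaw (hμ (S.type r)) (q r)
  have hw := integrable_id_waitLaw (hμ (S.type r)) (q r)
  have he := integrable_id_expMeasure (hμ (S.type r))
  have h1 := hw.1.comp_fst (expMeasure (μ (S.type r)))
  have h2 := he.1.comp_snd (waitLaw (μ (S.type r)) (q r))
  refine ⟨h1.add h2, ?_⟩
  rw [integral_add h1 h2, integral_fun_fst (fun y => y), integral_fun_snd (fun y => y), hw.2, he.2]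
  simp
  ring

end System

end LoadBalancing

namespace LoadBalancing

namespace System

variable {M : ℕ} {S : System M} {μ : Fin M → ℝ} {P : Policy} {p : S.State → ℝ}

/-! ### Routing -/

theorem fastest_nonempty {A : Finset (Fin S.numServers)} (hA : A.Nonempty) :
    (S.fastest μ A).Nonempty := by
  obtain ⟨r, hr, h⟩ := Finset.exists_max_image A (fun s => μ (S.type s)) hA
  exact ⟨r, Finset.mem_filter.2 ⟨hr, h⟩⟩

theorem candidates_nonempty (q : S.State) (l : Fin S.numPorts) :
    (S.candidates μ P q l).Nonempty := by
  cases P with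
  | JFSQ =>
    obtain ⟨r, hr, h⟩ := Finset.exists_min_image (S.nbrs l) q (S.nbrs_nonempty l)
    exact fastest_nonempty ⟨r, Finset.mem_filter.2 ⟨hr, h⟩⟩
  | JFIQ =>
    simp only [candidates]
    split_ifs with h
    · exact fastest_nonempty h
    · exact S.nbrs_nonempty l

theorem sum_routeProb (q : S.State) (l : Fin S.numPorts) : ∑ r, S.routeProb μ P q l r = 1 := by
  have h : ((S.candidates μ P q l).card : ℝ) ≠ 0 :=
    Nat.cast_ne_zero.2 (Finset.card_pos.2 (candidates_nonempty q l)).ne'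
  simp [routeProb, Finset.sum_ite_mem, h]

theorem sum_joinRate (q : S.State) : ∑ r, S.joinRate μ P q r = S.totalRate := by
  unfold joinRate totalRate
  rw [Finset.sum_comm]
  exact Finset.sum_congr rfl fun l _ => by rw [← Finset.mul_sum, sum_routeProb, mul_one]

/-- The idle servers whose type satisfies `k`. -/
noncomputable def idleOf (S : System M) (k : Fin M → Prop) (q : S.State) :
    Finset (Fin S.numServers) :=
  open Classical in Finset.univ.filter fun r => k (S.type r) ∧ (q r : ℕ) = 0

theorem mem_idleOf {k : Fin M → Prop} {q : S.State} {r : Fin S.numServers} :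
    r ∈ S.idleOf k q ↔ k (S.type r) ∧ (q r : ℕ) = 0 := by
  simp [idleOf]

theorem mem_idleOf_of_mem_fastest (hμ : StrictAnti μ) {k : Fin M → Prop}
    (hk : ∀ m m', m ≤ m' → k m' → k m) {q : S.State} {A : Finset (Fin S.numServers)}
    (hA : ∀ r ∈ A, (q r : ℕ) = 0) {s : Fin S.numServers} (hsA : s ∈ A) (hs : k (S.type s))
    {r : Fin S.numServers} (hr : r ∈ S.fastest μ A) : r ∈ S.idleOf k q := by
  obtain ⟨hrA, h⟩ := Finset.mem_filter.1 hr
  exact mem_idleOf.2 ⟨hk _ _ (hμ.le_iff_ge.1 (h s hsA)) hs, hA r hrA⟩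

/-- Both policies send an arrival to a fastest connected idle server if there is one. In
particular, if the types satisfying `k` are the fastest ones, then an arrival at a port connected
to an idle server of such a type is routed to an idle server of such a type. -/
theorem candidates_subset_idleOf (hμ : StrictAnti μ) {k : Fin M → Prop}
    (hk : ∀ m m', m ≤ m' → k m' → k m) {q : S.State} {l : Fin S.numPorts}
    (h : ¬Disjoint (S.nbrs l) (S.idleOf k q)) : S.candidates μ P q l ⊆ S.idleOf k q := by
  obtain ⟨s, hs, hs'⟩ := Finset.not_disjoint_iff.1 h
  obtain ⟨hks, hqs⟩ := mem_idleOf.1 hs'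
  intro r hr
  cases P with
  | JFSQ =>
    refine mem_idleOf_of_mem_fastest hμ hk (A := S.shortest q l) (fun r hr => ?_)
      (Finset.mem_filter.2 ⟨hs, fun s' _ => ?_⟩) hks hr
    · have := (Finset.mem_filter.1 hr).2 s hs
      rw [Fin.le_def] at this
      omega
    · rw [Fin.le_def]
      omega
  | JFIQ =>
    have hmem : s ∈ S.idle q l := Finset.mem_filter.2 ⟨hs, Fin.ext (by simpa using hqs)⟩
    simp only [candidates] at hr
    rw [if_pos ⟨s, hmem⟩] at hr
    refine mem_idleOf_of_mem_fastest hμ hk (A := S.idle q l) (fun r hr => ?_) hmem hks hr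
    simp [(Finset.mem_filter.1 hr).2]

theorem sum_joinRate_not_idleOf (hμ : StrictAnti μ) {k : Fin M → Prop} [DecidablePred k]
    (hk : ∀ m m', m ≤ m' → k m' → k m) (q : S.State) :
    ∑ r, S.joinRate μ P q r * (if k (S.type r) ∧ (q r : ℕ) = 0 then 0 else 1) ≤
      S.disconnected (S.idleOf k q) := by
  classical
  unfold joinRate disconnected
  simp only [Finset.sum_mul]
  rw [Finset.sum_comm]
  refine Finset.sum_le_sum fun l _ => ?_
  simp only [mul_assoc]
  rw [← Finset.mul_sum]
  split_ifs with h
  · refine mul_le_of_le_one_right (S.arrival_nonneg l) ?_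
    refine (Finset.sum_le_sum fun r _ => mul_le_of_le_one_right (routeProb_nonneg q l r) ?_).trans_eq
      (sum_routeProb (μ := μ) (P := P) q l)
    split_ifs <;> norm_num
  · rw [Finset.sum_eq_zero, mul_zero]
    intro r _
    split_ifs with hr
    · rw [mul_zero]
    · rw [mul_one, routeProb, if_neg]
      exact fun hc => hr (mem_idleOf.1 (candidates_subset_idleOf hμ hk h hc))

theorem totalRate_nonneg : 0 ≤ S.totalRate := Finset.sum_nonneg fun l _ => S.arrival_nonneg l

theorem totalRate_sub_admission (q : S.State) :
    S.totalRate - S.admission μ P q =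
      ∑ r, if (q r : ℕ) = S.buffer then S.joinRate μ P q r else 0 := by
  rw [← sum_joinRate (μ := μ) (P := P) q, admission, ← Finset.sum_sub_distrib]
  refine Finset.sum_congr rfl fun r _ => ?_
  have := (q r).is_lt
  by_cases h : (q r : ℕ) < S.buffer
  · simp [h, h.ne]
  · have h' : (q r : ℕ) = S.buffer := by omega
    simp [h']

theorem blockingProb_eq (hp : S.IsStationary μ P p) (h : 0 < S.totalRate) :
    S.blockingProb μ P p = 1 - mean p (S.admission μ P) / S.totalRate := by
  rw [eq_sub_iff_add_eq, blockingProb, ← add_div, div_eq_one_iff_eq h.ne', ← eq_sub_iff_add_eq]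
  rw [← mean_const hp.2.1 S.totalRate, ← mean_sub, mean]
  refine Finset.sum_congr rfl fun q _ => ?_
  rw [totalRate_sub_admission]
  congr 1
  simp only [Finset.mul_sum]
  rw [Finset.sum_comm]
  refine Finset.sum_congr rfl fun r _ => ?_
  split_ifs
  · rfl
  · simp

end System

end LoadBalancing

namespace LoadBalancing

/-! ### Consequences of the assumptions for one system -/

/-- The assumptions on one system, with enough servers that `log N ≥ 1`. -/
structure Regime {M : ℕ} (S : System M) (μ α : Fin M → ℝ) (K : Fin M) (β ε : ℝ) : Prop where
  rate_pos : ∀ m, 0 < μ m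
  rate_anti : StrictAnti μ
  frac_pos : ∀ m, 0 < α m
  frac_sum : ∑ m, α m = 1
  card_type : ∀ m, ((Finset.univ.filter fun r => S.type r = m).card : ℝ) = S.numServers * α m
  critical : IsCritical S μ α K
  load : S.totalRate = S.numServers * (∑ m ∈ Finset.Iic K, μ m * α m) * (1 - β)
  buffer : BufferAssumption S μ α K β ε
  connected : WellConnected S μ α K β ε
  one_le_log : 1 ≤ Real.log S.numServers

namespace Regime

variable {M : ℕ} {S : System M} {μ α : Fin M → ℝ} {K : Fin M} {β ε : ℝ}

theorem numServers_pos (h : Regime S μ α K β ε) : (0 : ℝ) < S.numServers := by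
  have h1 := h.one_le_log
  rcases Nat.eq_zero_or_pos S.numServers with h0 | h0
  · rw [h0] at h1
    norm_num at h1
  · exact_mod_cast h0

theorem one_le_tau (h : Regime S μ α K β ε) : 1 ≤ tau μ K := by
  rw [tau, one_le_div (h.rate_pos K)]
  exact h.rate_anti.antitone (Fin.mk_le_of_le_val (Nat.zero_le _))

theorem le_rate_zero (h : Regime S μ α K β ε) (m : Fin M) : μ m ≤ μ ⟨0, K.pos⟩ :=
  h.rate_anti.antitone (Fin.mk_le_of_le_val (Nat.zero_le _))

theorem rate_zero_eq (h : Regime S μ α K β ε) : μ ⟨0, K.pos⟩ = tau μ K * μ K := by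
  rw [tau, div_mul_cancel₀ _ (h.rate_pos K).ne']

theorem six_le_buffer (h : Regime S μ α K β ε) : (6 : ℝ) ≤ S.buffer := by
  have h1 : (1 : ℝ) ≤ √(tau μ K) := Real.one_le_sqrt.2 h.one_le_tau
  linarith [h.buffer.2.2.1]

theorem tau_le_sq_buffer (h : Regime S μ α K β ε) : 36 * tau μ K ≤ (S.buffer : ℝ) ^ 2 := by
  have h1 := pow_le_pow_left₀ (by positivity) h.buffer.2.2.1 2
  rw [mul_pow, Real.sq_sqrt (by linarith [h.one_le_tau])] at h1
  linarith

/-- The buffer size assumption without the rounding. -/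
theorem buffer_pow_le (h : Regime S μ α K β ε) :
    1152 * tau μ K * (S.buffer : ℝ) ^ 5 * Real.log S.numServers ≤ ε ^ 2 * S.numServers := by
  have hN := h.numServers_pos
  have hτ := h.one_le_tau
  have hl := h.one_le_log
  have hD : 0 < 1152 * tau μ K * Real.log S.numServers := by positivity
  set x : ℝ := ε ^ 2 * S.numServers / (1152 * tau μ K * Real.log S.numServers) with hx
  have hx0 : 0 ≤ x := by positivity
  have h1 : (S.buffer : ℝ) ≤ x ^ (1 / 5 : ℝ) :=
    (Nat.cast_le.2 h.buffer.2.2.2).trans (Nat.floor_le (Real.rpow_nonneg hx0 _))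
  have h2 := pow_le_pow_left₀ (Nat.cast_nonneg _) h1 5
  rw [← Real.rpow_natCast (x ^ (1 / 5 : ℝ)) 5, ← Real.rpow_mul hx0] at h2
  norm_num at h2
  rw [hx, le_div_iff₀ hD] at h2
  linarith

theorem eps_pos (h : Regime S μ α K β ε) : 0 < ε := h.buffer.1

theorem four_eps_le (h : Regime S μ α K β ε) : 4 * ε ≤ betaHat α K β := by
  linarith [h.buffer.2.1]

theorem sum_frac_Iic_pos (h : Regime S μ α K β ε) : 0 < ∑ m ∈ Finset.Iic K, α m :=
  Finset.sum_pos (fun m _ => h.frac_pos m) ⟨K, Finset.mem_Iic.2 le_rfl⟩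

theorem sum_frac_le_one (h : Regime S μ α K β ε) (s : Finset (Fin M)) : ∑ m ∈ s, α m ≤ 1 := by
  rw [← h.frac_sum]
  exact Finset.sum_le_univ_sum_of_nonneg fun m => (h.frac_pos m).le

theorem beta_pos (h : Regime S μ α K β ε) : 0 < β := by
  have h1 := h.four_eps_le
  have h2 := h.eps_pos
  unfold betaHat at h1
  exact pos_of_mul_pos_left (by linarith) h.sum_frac_Iic_pos.le

theorem beta_le_one (h : Regime S μ α K β ε) : β ≤ 1 := by
  have h1 : 0 < ∑ m ∈ Finset.Iic K, μ m * α m :=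
    Finset.sum_pos (fun m _ => mul_pos (h.rate_pos m) (h.frac_pos m))
      ⟨K, Finset.mem_Iic.2 le_rfl⟩
  have h2 := System.totalRate_nonneg (S := S)
  rw [h.load] at h2
  have h3 := nonneg_of_mul_nonneg_right h2 (mul_pos h.numServers_pos h1)
  linarith

theorem eps_le (h : Regime S μ α K β ε) : ε ≤ 1 / 4 := by
  have h1 := h.four_eps_le
  have h2 : betaHat α K β ≤ 1 * 1 :=
    mul_le_mul h.beta_le_one (h.sum_frac_le_one _) h.sum_frac_Iic_pos.le zero_le_one
  linarith

/-- Sums over servers of a function of the type. -/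
theorem sum_type (h : Regime S μ α K β ε) (s : Finset (Fin M)) (g : Fin M → ℝ) :
    (∑ r, if S.type r ∈ s then g (S.type r) else 0) = S.numServers * ∑ m ∈ s, g m * α m := by
  have h1 : ∀ r, (if S.type r ∈ s then g (S.type r) else 0) =
      ∑ m ∈ s, if S.type r = m then g m else 0 := fun r => (Finset.sum_ite_eq s _ _).symm
  simp only [h1]
  rw [Finset.sum_comm, Finset.mul_sum]
  refine Finset.sum_congr rfl fun m _ => ?_
  rw [← Finset.sum_filter, Finset.sum_const, nsmul_eq_mul, h.card_type]
  ring

theorem sum_rate_Iio_le (h : Regime S μ α K β ε) :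
    S.numServers * ∑ m ∈ Finset.Iio K, μ m * α m ≤ S.totalRate := by
  rcases Nat.eq_zero_or_pos (K : ℕ) with h0 | h0
  · have : Finset.Iio K = ∅ := by
      ext m
      simp only [Finset.mem_Iio, Finset.notMem_empty, iff_false, not_lt, Fin.le_def]
      omega
    rw [this, Finset.sum_empty, mul_zero]
    exact System.totalRate_nonneg
  · set k : Fin M := ⟨(K : ℕ) - 1, by omega⟩ with hk
    have hlt : k < K := by
      rw [Fin.lt_def, hk]
      simp only
      omega
    have : Finset.Iio K = Finset.Iic k := by
      ext m
      simp only [Finset.mem_Iio, Finset.mem_Iic, Fin.le_def, Fin.lt_def, hk]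
      omega
    rw [this]
    by_contra! hc
    exact absurd (h.critical.2 hc) (not_le.2 hlt)

theorem totalRate_lt (h : Regime S μ α K β ε) :
    S.totalRate < S.numServers * ∑ m ∈ Finset.Iic K, μ m * α m := h.critical.1

theorem sum_rate_le (h : Regime S μ α K β ε) (s : Finset (Fin M)) :
    ∑ m ∈ s, μ m * α m ≤ μ ⟨0, K.pos⟩ := by
  calc ∑ m ∈ s, μ m * α m ≤ ∑ m ∈ s, μ ⟨0, K.pos⟩ * α m :=
        Finset.sum_le_sum fun m _ => mul_le_mul_of_nonneg_right (h.le_rate_zero m) (h.frac_pos m).le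
    _ = μ ⟨0, K.pos⟩ * ∑ m ∈ s, α m := by rw [Finset.mul_sum]
    _ ≤ μ ⟨0, K.pos⟩ := mul_le_of_le_one_right (h.rate_pos _).le (h.sum_frac_le_one s)

theorem totalRate_le (h : Regime S μ α K β ε) :
    S.totalRate ≤ S.numServers * μ ⟨0, K.pos⟩ :=
  h.totalRate_lt.le.trans (mul_le_mul_of_nonneg_left (h.sum_rate_le _) h.numServers_pos.le)

theorem sum_rate_server_le (h : Regime S μ α K β ε) :
    ∑ r, μ (S.type r) ≤ S.numServers * μ ⟨0, K.pos⟩ := by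
  have h1 := h.sum_type Finset.univ μ
  simp only [Finset.mem_univ, if_true] at h1
  rw [h1]
  exact mul_le_mul_of_nonneg_left (h.sum_rate_le _) h.numServers_pos.le

theorem sum_Iic_eq (f : Fin M → ℝ) (K : Fin M) :
    ∑ m ∈ Finset.Iic K, f m = ∑ m ∈ Finset.Iio K, f m + f K := by
  rw [← Finset.Iio_insert, Finset.sum_insert (by simp), add_comm]

/-- The spare capacity of the types up to `K`. -/
theorem spare_capacity (h : Regime S μ α K β ε) :
    S.numServers * ∑ m ∈ Finset.Iic K, μ m * α m - S.totalRate =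
      S.numServers * (μ K * (∑ m ∈ Finset.Iic K, α m - cStar μ α K S.normRate)) := by
  have hN := h.numServers_pos.ne'
  have hK := (h.rate_pos K).ne'
  rw [sum_Iic_eq, sum_Iic_eq, cStar, System.normRate]
  field_simp
  ring

theorem betaHat_le (h : Regime S μ α K β ε) :
    betaHat α K β ≤ ∑ m ∈ Finset.Iic K, α m - cStar μ α K S.normRate := by
  have hN := h.numServers_pos
  have hK := h.rate_pos K
  have h1 := h.spare_capacity
  have h2 : μ K * ∑ m ∈ Finset.Iic K, α m ≤ ∑ m ∈ Finset.Iic K, μ m * α m := by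
    rw [Finset.mul_sum]
    exact Finset.sum_le_sum fun m hm => mul_le_mul_of_nonneg_right
      (h.rate_anti.antitone (Finset.mem_Iic.1 hm)) (h.frac_pos m).le
  have h3 : S.numServers * (μ K * betaHat α K β) ≤
      S.numServers * (μ K * (∑ m ∈ Finset.Iic K, α m - cStar μ α K S.normRate)) := by
    rw [← h1, h.load, betaHat]
    nlinarith [mul_le_mul_of_nonneg_left h2 (mul_pos hN h.beta_pos).le]
  exact le_of_mul_le_mul_left (le_of_mul_le_mul_left h3 hN) hK

theorem cStar_nonneg (h : Regime S μ α K β ε) : 0 ≤ cStar μ α K S.normRate := by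
  have hN := h.numServers_pos
  refine add_nonneg (Finset.sum_nonneg fun m _ => (h.frac_pos m).le)
    (div_nonneg ?_ (h.rate_pos K).le)
  rw [System.normRate, sub_nonneg, le_div_iff₀ hN]
  linarith [h.sum_rate_Iio_le]

theorem cStar_le_one (h : Regime S μ α K β ε) : cStar μ α K S.normRate ≤ 1 := by
  linarith [h.betaHat_le, h.four_eps_le, h.eps_pos, h.sum_frac_le_one (Finset.Iic K)]

end Regime

end LoadBalancing

namespace LoadBalancing

namespace System

variable {M : ℕ} {S : System M} {μ : Fin M → ℝ} {P : Policy} {p : S.State → ℝ}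

/-! ### Idle servers of the fast types -/

/-- The number of idle servers of types less than `K`. -/
noncomputable def idleFast (S : System M) (K : Fin M) (q : S.State) : ℝ :=
  ∑ r, if S.type r < K ∧ (q r : ℕ) = 0 then 1 else 0

/-- The number of busy servers of types at most `K`. -/
noncomputable def busy (S : System M) (K : Fin M) (q : S.State) : ℝ :=
  ∑ r, if S.type r ≤ K ∧ 0 < (q r : ℕ) then 1 else 0

/-- The number of jobs waiting at servers of types at most `K`. -/
noncomputable def waiting (S : System M) (K : Fin M) (q : S.State) : ℝ :=
  ∑ r, if S.type r ≤ K then (((q r : ℕ) - 1 : ℕ) : ℝ) else 0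

theorem card_idleOf (k : Fin M → Prop) [DecidablePred k] (q : S.State) :
    ((S.idleOf k q).card : ℝ) = ∑ r, if k (S.type r) ∧ (q r : ℕ) = 0 then 1 else 0 := by
  classical
  rw [idleOf, Finset.card_filter]
  push_cast
  refine Finset.sum_congr rfl fun r _ => ?_
  split_ifs <;> rfl

theorem totalRate_sub_le (hμ : StrictAnti μ) {k : Fin M → Prop} [DecidablePred k]
    (hk : ∀ m m', m ≤ m' → k m' → k m) (q : S.State) :
    S.totalRate - S.disconnected (S.idleOf k q) ≤
      ∑ r, S.joinRate μ P q r * (if k (S.type r) ∧ (q r : ℕ) = 0 then 1 else 0) := by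
  have h1 := sum_joinRate_not_idleOf (P := P) hμ hk q
  rw [← sum_joinRate (μ := μ) (P := P) q, sub_le_comm, ← Finset.sum_sub_distrib]
  refine le_trans (Finset.sum_le_sum fun r _ => ?_) h1
  split_ifs <;> simp

theorem idleFast_up (hb : 0 < S.buffer) (K : Fin M) (q : S.State) (r : Fin S.numServers) :
    S.idleFast K (S.up q r) = S.idleFast K q - if S.type r < K ∧ (q r : ℕ) = 0 then 1 else 0 := by
  rw [eq_sub_iff_add_eq, ← eq_sub_iff_add_eq', eq_comm, idleFast, idleFast,
    ← Finset.sum_sub_distrib, Finset.sum_eq_single r]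
  · simp only [up, Function.update_self]
    have : ¬(min ((q r : ℕ) + 1) S.buffer = 0) := by omega
    simp [this]
  · intro s _ hs
    simp [up, hs]
  · simp

theorem idleFast_down (K : Fin M) (q : S.State) (r : Fin S.numServers) :
    S.idleFast K (S.down q r) = S.idleFast K q + if S.type r < K ∧ (q r : ℕ) = 1 then 1 else 0 := by
  rw [← sub_eq_iff_eq_add', idleFast, idleFast, ← Finset.sum_sub_distrib, Finset.sum_eq_single r]
  · simp only [down, Function.update_self]
    rcases Nat.lt_trichotomy (q r : ℕ) 1 with h | h | h
    · have h' : (q r : ℕ) = 0 := by omega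
      simp [h']
    · simp [h]
    · have h1 : ¬((q r : ℕ) - 1 = 0) := by omega
      have h2 : ¬((q r : ℕ) = 0) := by omega
      have h3 : ¬((q r : ℕ) = 1) := by omega
      simp [h1, h2, h3]
  · intro s _ hs
    simp [down, hs]
  · simp

/-- The drift of an exponential of the number of idle fast servers. -/
theorem gen_exp_idleFast (hb : 0 < S.buffer) (K : Fin M) (θ : ℝ) (q : S.State) :
    S.gen μ P (fun q => Real.exp (θ * S.idleFast K q)) q = Real.exp (θ * S.idleFast K q) *
      ((∑ r, S.joinRate μ P q r * (if S.type r < K ∧ (q r : ℕ) = 0 then 1 else 0)) *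
          (Real.exp (-θ) - 1) +
        (∑ r, if S.type r < K ∧ (q r : ℕ) = 1 then μ (S.type r) else 0) *
          (Real.exp θ - 1)) := by
  rw [gen, mul_add, Finset.sum_mul, Finset.sum_mul, Finset.mul_sum, Finset.mul_sum]
  congr 1 <;> refine Finset.sum_congr rfl fun r _ => ?_
  · rw [idleFast_up hb]
    split_ifs
    · rw [mul_sub θ, mul_one, sub_eq_add_neg (θ * _), Real.exp_add]
      ring
    · simp
  · rw [idleFast_down]
    split_ifs
    · rw [mul_add θ, mul_one, Real.exp_add]
      ring
    · simp

end System

theorem exp_neg_sub_one_le {θ : ℝ} (h0 : 0 ≤ θ) (h1 : θ ≤ 1) : Real.exp (-θ) - 1 ≤ -(θ / 2) := by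
  have h := Real.abs_exp_sub_one_sub_id_le (x := -θ) (by rwa [abs_neg, abs_of_nonneg h0])
  have := (abs_le.1 h).2
  have h2 := Real.add_one_le_exp θ
  have h3 : Real.exp (-θ) ≤ 1 / (1 + θ) := by
    rw [Real.exp_neg, one_div]
    exact inv_anti₀ (by linarith) (by linarith)
  have h4 : 1 / (1 + θ) ≤ 1 - θ / 2 := by
    rw [div_le_iff₀ (by linarith)]
    nlinarith
  linarith

theorem exp_sub_one_le {θ : ℝ} (h0 : 0 ≤ θ) (h1 : θ ≤ 1) : Real.exp θ - 1 ≤ 2 * θ := by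
  have h := Real.abs_exp_sub_one_sub_id_le (x := θ) (by rwa [abs_of_nonneg h0])
  have := (abs_le.1 h).2
  nlinarith

theorem exp_add_exp_neg_le {θ : ℝ} (h0 : 0 ≤ θ) (h1 : θ ≤ 1) :
    (Real.exp θ - 1) + (Real.exp (-θ) - 1) ≤ 2 * θ ^ 2 := by
  have h := Real.abs_exp_sub_one_sub_id_le (x := θ) (by rwa [abs_of_nonneg h0])
  have h' := Real.abs_exp_sub_one_sub_id_le (x := -θ) (by rwa [abs_neg, abs_of_nonneg h0])
  have := (abs_le.1 h).2
  have := (abs_le.1 h').2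
  nlinarith

namespace Regime

variable {M : ℕ} {S : System M} {μ α : Fin M → ℝ} {K : Fin M} {β ε : ℝ} {P : Policy}
  {p : S.State → ℝ}

open LoadBalancing.System

theorem buffer_pos (h : Regime S μ α K β ε) : 0 < S.buffer := by
  have := h.six_le_buffer
  exact_mod_cast (by linarith : (0 : ℝ) < S.buffer)

/-- The rate at which fast servers become idle. -/
theorem sum_rate_becoming_idle_le (h : Regime S μ α K β ε) (q : S.State) :
    (∑ r, if S.type r < K ∧ (q r : ℕ) = 1 then μ (S.type r) else 0) ≤
      S.totalRate - μ K * S.idleFast K q := by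
  have h1 := h.sum_type (Finset.Iio K) μ
  simp only [Finset.mem_Iio] at h1
  refine le_trans ?_ (sub_le_sub_right h.sum_rate_Iio_le _)
  rw [← h1, idleFast, Finset.mul_sum, ← Finset.sum_sub_distrib]
  refine Finset.sum_le_sum fun r _ => ?_
  have hr := (h.rate_pos (S.type r)).le
  by_cases ht : S.type r < K
  · have := (h.rate_anti ht).le
    by_cases h0 : (q r : ℕ) = 0
    · simp [ht, h0, this]
    · by_cases h1 : (q r : ℕ) = 1
      · simp [ht, h1]
      · simp [ht, h0, h1, hr]
  · simp [ht]

/-- With probability close to one, few fast servers are idle: while at least `N ε / (6 b ^ 2)` of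
them are idle, well-connectedness sends almost every arrival to one of them, and the drift of
their number is negative. An exponential Lyapunov function turns this into a tail bound, in which
the assumption on the buffer size makes the exponent a multiple of `log N`. -/
theorem prob_idleFast_le (h : Regime S μ α K β ε) (hp : S.IsStationary μ P p) :
    mean p (fun q => if S.numServers * (ε / (3 * (S.buffer : ℝ) ^ 2)) ≤ S.idleFast K q
      then 1 else 0) ≤ ((S.numServers : ℝ) ^ 3)⁻¹ := by
  have hN := h.numServers_pos
  have hb := h.six_le_buffer
  have hτ := h.one_le_tau
  have hK := h.rate_pos K
  have hε := h.eps_pos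
  have hε1 := h.eps_le
  have hlog := h.one_le_log
  have hpow := h.buffer_pow_le
  have hμ1 := h.rate_zero_eq
  set N : ℝ := (S.numServers : ℝ) with hNdef
  set b : ℝ := (S.buffer : ℝ) with hbdef
  set τ := tau μ K with hτdef
  set μ₁ := μ ⟨0, K.pos⟩ with hμ₁def
  set x : ℝ := ε / (6 * b ^ 2) with hx
  have hμ₁ : 0 < μ₁ := h.rate_pos _
  have hx0 : 0 < x := by positivity
  have hx1 : x ≤ 1 := by
    rw [hx, div_le_one (by positivity)]
    nlinarith
  have hx2 : ε / (3 * b ^ 2) = 2 * x := by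
    rw [hx]
    field_simp
    norm_num
  -- The exponent makes the first-order drift, of order `μ K * x * θ`, dominate the second-order
  -- term, of order `μ₁ * θ ^ 2`.
  set θ : ℝ := x / (16 * τ) with hθ
  have hθ0 : 0 < θ := by positivity
  have hθ1 : θ ≤ 1 := by
    rw [hθ, div_le_one (by positivity)]
    linarith
  obtain ⟨d₁, d₂, hd₁, -, hD, -⟩ := h.connected
  have hd₁x : d₁ ≤ μ K * x / 2 := by
    refine hd₁.trans ?_
    rw [hx, mul_div_assoc', div_div, div_le_div_iff₀ (by positivity) (by positivity)]
    have : 0 < ε * μ K := by positivity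
    nlinarith [mul_le_mul_of_nonneg_left (by linarith : (1 : ℝ) ≤ b)
      (by positivity : 0 ≤ ε * μ K * b ^ 2)]
  -- The drift inequality for the exponential Lyapunov function.
  have hdrift : ∀ q, S.gen μ P (fun q => Real.exp (θ * S.idleFast K q)) q ≤
      2 * N * μ₁ * θ * Real.exp (θ * (x * N)) - N * μ₁ * θ ^ 2 * 2 * (Real.exp (2 * (θ * (x * N))) *
        if N * (ε / (3 * b ^ 2)) ≤ S.idleFast K q then 1 else 0) := by
    intro q
    rw [gen_exp_idleFast h.buffer_pos]
    set X := S.idleFast K q with hX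
    set d := ∑ r, S.joinRate μ P q r * (if S.type r < K ∧ (q r : ℕ) = 0 then 1 else 0) with hd
    set u := ∑ r, (if S.type r < K ∧ (q r : ℕ) = 1 then μ (S.type r) else 0) with hu
    have hX0 : 0 ≤ X := Finset.sum_nonneg fun r _ => by split_ifs <;> norm_num
    have hu0 : 0 ≤ u := Finset.sum_nonneg fun r _ => by
      split_ifs
      · exact (h.rate_pos _).le
      · exact le_rfl
    have hd0 : 0 ≤ d := Finset.sum_nonneg fun r _ => mul_nonneg (joinRate_nonneg q r) (by
      split_ifs <;> norm_num)
    have hu1 : u ≤ S.totalRate - μ K * X := h.sum_rate_becoming_idle_le q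
    have hu2 : u ≤ N * μ₁ := by linarith [h.totalRate_le, mul_nonneg hK.le hX0]
    have he1 := exp_neg_sub_one_le hθ0.le hθ1
    have he2 := exp_sub_one_le hθ0.le hθ1
    have he3 := exp_add_exp_neg_le hθ0.le hθ1
    have he4 : 0 ≤ Real.exp θ - 1 := by linarith [Real.add_one_le_exp θ]
    have hpos : 0 ≤ 2 * N * μ₁ * θ * Real.exp (θ * (x * N)) := by positivity
    rw [hx2]
    by_cases hcase : N * x ≤ X
    · -- Almost all arrivals join idle fast servers.
      have hdis : S.disconnected (S.idleOf (fun m => m < K) q) ≤ N * d₁ := by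
        refine hD _ (fun r hr => (mem_idleOf.1 hr).1) ?_
        rw [card_idleOf]
        exact hcase
      have hd1 := totalRate_sub_le (P := P) h.rate_anti (k := fun m => m < K)
        (fun m m' h1 h2 => h1.trans_lt h2) q
      have hdu : u + N * (μ K * x / 2) ≤ d := by
        have := mul_le_mul_of_nonneg_left hd₁x hN.le
        have := mul_le_mul_of_nonneg_left hcase hK.le
        linarith
      have hbr : d * (Real.exp (-θ) - 1) + u * (Real.exp θ - 1) ≤ -(N * μ₁ * θ ^ 2 * 2) := by
        have h1 : d * (Real.exp (-θ) - 1) ≤ (u + N * (μ K * x / 2)) * (Real.exp (-θ) - 1) :=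
          mul_le_mul_of_nonpos_right hdu (by linarith)
        have h2 : u * ((Real.exp θ - 1) + (Real.exp (-θ) - 1)) ≤ N * μ₁ * (2 * θ ^ 2) :=
          mul_le_mul hu2 he3 (by
            have := Real.add_one_le_exp θ
            have := Real.add_one_le_exp (-θ)
            linarith) (by positivity)
        have h3 : N * (μ K * x / 2) * (Real.exp (-θ) - 1) ≤ N * (μ K * x / 2) * (-(θ / 2)) :=
          mul_le_mul_of_nonneg_left he1 (by positivity)
        have h4 : μ K * x = 16 * μ₁ * θ := by
          rw [hθ, hμ1]
          field_simp
        rw [h4] at h1 h3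
        linarith
      have hle : Real.exp (2 * (θ * (x * N))) * (if N * (2 * x) ≤ X then 1 else 0) ≤
          Real.exp (θ * X) := by
        split_ifs with hc
        · rw [mul_one]
          refine Real.exp_le_exp.2 ?_
          linarith [mul_le_mul_of_nonneg_left hc hθ0.le]
        · rw [mul_zero]
          exact (Real.exp_pos _).le
      have h5 := mul_le_mul_of_nonneg_left hbr (Real.exp_pos (θ * X)).le
      have h6 := mul_le_mul_of_nonneg_left hle (by positivity : 0 ≤ N * μ₁ * θ ^ 2 * 2)
      linarith
    · rw [if_neg (by linarith [mul_pos hN hx0]), mul_zero, mul_zero, sub_zero]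
      have h1 : d * (Real.exp (-θ) - 1) ≤ 0 := mul_nonpos_of_nonneg_of_nonpos hd0 (by linarith)
      have h2 : u * (Real.exp θ - 1) ≤ N * μ₁ * (2 * θ) :=
        mul_le_mul hu2 he2 he4 (by positivity)
      have h3 : Real.exp (θ * X) ≤ Real.exp (θ * (x * N)) :=
        Real.exp_le_exp.2 (mul_le_mul_of_nonneg_left (by linarith) hθ0.le)
      calc Real.exp (θ * X) * (d * (Real.exp (-θ) - 1) + u * (Real.exp θ - 1))
          ≤ Real.exp (θ * X) * (N * μ₁ * (2 * θ)) :=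
            mul_le_mul_of_nonneg_left (by linarith) (Real.exp_pos _).le
        _ ≤ Real.exp (θ * (x * N)) * (N * μ₁ * (2 * θ)) :=
            mul_le_mul_of_nonneg_right h3 (by positivity)
        _ = _ := by ring
  have hmean := mean_mono hp.1 hdrift
  rw [mean_gen hp, mean_sub, mean_const hp.2.1, mean_const_mul, mean_const_mul, two_mul (θ * _),
    Real.exp_add] at hmean
  set B := mean p (fun q => if N * (ε / (3 * b ^ 2)) ≤ S.idleFast K q then (1 : ℝ) else 0) with hB
  have hE := Real.exp_pos (θ * (x * N))
  have h1 : θ * Real.exp (θ * (x * N)) * B ≤ 1 := by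
    have : 0 < 2 * N * μ₁ * θ * Real.exp (θ * (x * N)) := by positivity
    refine le_of_mul_le_mul_left ?_ this
    linarith
  -- The exponent is at least `12 log N`.
  have h2 : 4 * Real.log N ≤ θ * (x * N) := by
    have : θ * (x * N) = ε ^ 2 * N / (576 * τ * b ^ 4) := by
      rw [hθ, hx]
      field_simp
      norm_num
    rw [this, le_div_iff₀ (by positivity)]
    refine le_trans ?_ hpow
    have : 0 ≤ 576 * τ * b ^ 4 * Real.log N := by positivity
    linarith [mul_le_mul_of_nonneg_left hb this]
  have h3 : N ^ 4 ≤ Real.exp (θ * (x * N)) := by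
    refine le_trans (le_of_eq ?_) (Real.exp_le_exp.2 h2)
    rw [mul_comm, Real.exp_mul, Real.exp_log hN]
    norm_cast
  have h4 : 1 ≤ θ * N := by
    have : θ * N = ε * N / (96 * τ * b ^ 2) := by
      rw [hθ, hx]
      field_simp
      norm_num
    rw [this, le_div_iff₀ (by positivity)]
    have h5 : 1152 * τ * b ^ 2 ≤ ε ^ 2 * N := by
      refine le_trans ?_ hpow
      have hb3 : (1 : ℝ) ≤ b ^ 3 * Real.log N := by
        exact one_le_mul_of_one_le_of_one_le (one_le_pow₀ (by linarith)) hlog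
      have : 0 ≤ 1152 * τ * b ^ 2 := by positivity
      linarith [mul_le_mul_of_nonneg_left hb3 this]
    have h6 : ε ^ 2 * N ≤ ε * N := by
      rw [sq, mul_assoc]
      exact mul_le_of_le_one_left (by positivity) (by linarith)
    have : 0 ≤ τ * b ^ 2 := by positivity
    linarith
  have hB0 : 0 ≤ B := mean_nonneg hp.1 fun q => by split_ifs <;> norm_num
  rw [← one_div, le_div_iff₀ (by positivity)]
  calc B * N ^ 3 = 1 * N ^ 3 * B := by ring
    _ ≤ θ * N * N ^ 3 * B := by gcongr
    _ = θ * N ^ 4 * B := by ring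
    _ ≤ θ * Real.exp (θ * (x * N)) * B := by gcongr
    _ ≤ 1 := h1

end Regime

end LoadBalancing

namespace LoadBalancing

/-! ### A smoothed Lyapunov function -/

/-- A smoothing of the positive part: it vanishes for `t ≤ 0`, has slope one for `t ≥ κ`, and is
quadratic in between. -/
noncomputable def softPos (κ t : ℝ) : ℝ := ((max t 0) ^ 2 - (max (t - κ) 0) ^ 2) / (2 * κ)

/-- The derivative of `softPos κ`. -/
noncomputable def softSlope (κ t : ℝ) : ℝ := (max t 0 - max (t - κ) 0) / κ

theorem max_add_sq_le (t h : ℝ) : (max (t + h) 0) ^ 2 ≤ (max t 0 + h) ^ 2 := by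
  rcases le_total (t + h) 0 with h1 | h1
  · rw [max_eq_right h1]
    nlinarith [sq_nonneg (max t 0 + h)]
  · rw [max_eq_left h1]
    exact pow_le_pow_left₀ h1 (by linarith [le_max_left t 0]) 2

theorem le_max_add_sq (t h : ℝ) : (max t 0) ^ 2 + 2 * max t 0 * h ≤ (max (t + h) 0) ^ 2 := by
  rcases le_total t 0 with h1 | h1
  · rw [max_eq_right h1]
    nlinarith [sq_nonneg (max (t + h) 0)]
  · rw [max_eq_left h1]
    rcases le_total (t + h) 0 with h2 | h2
    · rw [max_eq_right h2]
      nlinarith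
    · rw [max_eq_left h2]
      nlinarith [sq_nonneg h]

theorem softPos_add_sub_le {κ : ℝ} (hκ : 0 < κ) (t h : ℝ) :
    |softPos κ (t + h) - softPos κ t - softSlope κ t * h| ≤ h ^ 2 / (2 * κ) := by
  have h1 := max_add_sq_le t h
  have h2 := le_max_add_sq t h
  have h3 := max_add_sq_le (t - κ) h
  have h4 := le_max_add_sq (t - κ) h
  have h5 : t + h - κ = t - κ + h := by ring
  have h6 : softPos κ (t + h) - softPos κ t - softSlope κ t * h =
      (((max (t + h) 0) ^ 2 - (max t 0) ^ 2 - 2 * max t 0 * h) -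
        ((max (t - κ + h) 0) ^ 2 - (max (t - κ) 0) ^ 2 - 2 * max (t - κ) 0 * h)) / (2 * κ) := by
    unfold softPos softSlope
    rw [h5]
    field_simp
    ring
  rw [h6, abs_div, abs_of_pos (by positivity : 0 < 2 * κ)]
  refine div_le_div_of_nonneg_right (abs_le.2 ⟨?_, ?_⟩) (by positivity) <;> nlinarith

theorem softSlope_nonneg {κ : ℝ} (hκ : 0 < κ) (t : ℝ) : 0 ≤ softSlope κ t :=
  div_nonneg (sub_nonneg.2 (max_le_max (by linarith) le_rfl)) hκ.le

theorem softSlope_le_one {κ : ℝ} (hκ : 0 < κ) (t : ℝ) : softSlope κ t ≤ 1 := by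
  rw [softSlope, div_le_one hκ, sub_le_iff_le_add]
  refine max_le ?_ ?_
  · linarith [le_max_left (t - κ) 0]
  · linarith [le_max_right (t - κ) 0]

theorem softSlope_eq_zero {κ t : ℝ} (hκ : 0 < κ) (ht : t ≤ 0) : softSlope κ t = 0 := by
  rw [softSlope, max_eq_right ht, max_eq_right (by linarith), sub_zero, zero_div]

theorem softSlope_eq_one {κ t : ℝ} (hκ : 0 < κ) (ht : κ ≤ t) : softSlope κ t = 1 := by
  rw [softSlope, max_eq_left (by linarith), max_eq_left (by linarith), sub_sub_cancel,
    div_self hκ.ne']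

theorem softPos_eq {κ t : ℝ} (hκ : 0 < κ) (ht : κ ≤ t) : softPos κ t = t - κ / 2 := by
  rw [softPos, max_eq_left (by linarith), max_eq_left (by linarith)]
  field_simp
  ring

theorem softPos_le_half {κ t : ℝ} (hκ : 0 < κ) (ht : t ≤ κ) : softPos κ t ≤ κ / 2 := by
  rw [softPos, max_eq_right (by linarith : t - κ ≤ 0), div_le_iff₀ (by positivity)]
  have := pow_le_pow_left₀ (le_max_right t 0) (max_le ht hκ.le) 2
  nlinarith

theorem sub_half_le_softPos {κ : ℝ} (hκ : 0 < κ) (t : ℝ) : t - κ / 2 ≤ softPos κ t := by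
  rcases le_total κ t with h | h
  · rw [softPos_eq hκ h]
  · rw [softPos, max_eq_right (by linarith : t - κ ≤ 0), le_div_iff₀ (by positivity)]
    rcases le_total t 0 with h0 | h0
    · rw [max_eq_right h0]
      nlinarith
    · rw [max_eq_left h0]
      nlinarith [sq_nonneg (t - κ)]

theorem softPos_le {κ t : ℝ} (hκ : 0 < κ) (ht : 0 ≤ t) : softPos κ t ≤ t := by
  rcases le_total κ t with h | h
  · rw [softPos_eq hκ h]
    linarith
  · rw [softPos, max_eq_right (by linarith : t - κ ≤ 0), max_eq_left ht,
      div_le_iff₀ (by positivity)]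
    nlinarith

/-- One transition, in which `w` moves by `h` and `z` by `k`. -/
theorem excess_sq_sub_le {κ c L w z h k : ℝ} (hκ : 1 / 2 ≤ κ) (hhk : |h| + |k| ≤ 1) :
    (max (z + k + softPos κ (w + h - c) - L) 0) ^ 2 / 2 -
        (max (z + softPos κ (w - c) - L) 0) ^ 2 / 2 ≤
      max (z + softPos κ (w - c) - L) 0 * (k + softSlope κ (w - c) * h) +
        (max (z + softPos κ (w - c) - L) 0 / (2 * κ) + 2) := by
  have hκ0 : 0 < κ := by linarith
  set y := max (z + softPos κ (w - c) - L) 0 with hy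
  have hy0 : 0 ≤ y := le_max_right _ _
  set Δ := k + (softPos κ (w - c + h) - softPos κ (w - c)) with hΔ
  have h1 := max_add_sq_le (z + softPos κ (w - c) - L) Δ
  have h2 : z + k + softPos κ (w + h - c) - L = z + softPos κ (w - c) - L + Δ := by
    rw [hΔ, show w + h - c = w - c + h by ring]
    ring
  rw [← hy] at h1
  rw [h2]
  have h3 := abs_le.1 (softPos_add_sub_le hκ0 (w - c) h)
  have hh : h ^ 2 ≤ 1 := by
    rw [← sq_abs]
    exact pow_le_one₀ (abs_nonneg h) (by linarith [abs_nonneg k])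
  have h4 : h ^ 2 / (2 * κ) ≤ 1 / (2 * κ) := div_le_div_of_nonneg_right hh (by positivity)
  have h5 : 1 / (2 * κ) ≤ 1 := by
    rw [div_le_one (by positivity)]
    linarith
  have h6 : |softSlope κ (w - c) * h| ≤ |h| := by
    rw [abs_mul, abs_of_nonneg (softSlope_nonneg hκ0 _)]
    exact mul_le_of_le_one_left (abs_nonneg h) (softSlope_le_one hκ0 _)
  have h7 : |Δ| ≤ 2 := by
    rw [abs_le] at h6 ⊢
    have := abs_le.1 (le_refl |k|)
    constructor <;> linarith
  have h8 : Δ ^ 2 ≤ 4 := by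
    rw [← sq_abs]
    calc |Δ| ^ 2 ≤ 2 ^ 2 := pow_le_pow_left₀ (abs_nonneg _) h7 2
      _ = 4 := by norm_num
  have h9 : y * Δ ≤ y * (k + softSlope κ (w - c) * h + 1 / (2 * κ)) :=
    mul_le_mul_of_nonneg_left (by linarith) hy0
  have h10 : y / (2 * κ) = y * (1 / (2 * κ)) := by ring
  rw [h10]
  linarith

namespace System

variable {M : ℕ} {S : System M} {μ : Fin M → ℝ} {P : Policy} {p : S.State → ℝ}

theorem abs_busy_waiting_up (hb : 0 < S.buffer) (K : Fin M) (q : S.State)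
    (r : Fin S.numServers) :
    |S.busy K (S.up q r) - S.busy K q| + |S.waiting K (S.up q r) - S.waiting K q| ≤ 1 := by
  have h1 := sum_update_sub (fun s k => if S.type s ≤ K ∧ 0 < k then (1 : ℝ) else 0) q r
    ⟨min ((q r : ℕ) + 1) S.buffer, by omega⟩
  have h2 := sum_update_sub (fun s k => if S.type s ≤ K then ((k - 1 : ℕ) : ℝ) else 0) q r
    ⟨min ((q r : ℕ) + 1) S.buffer, by omega⟩
  unfold busy waiting up
  rw [h1, h2]
  by_cases ht : S.type r ≤ K
  · have hlt := (q r).is_lt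
    rcases Nat.eq_zero_or_pos (q r : ℕ) with h0 | h0
    · simp [ht, h0, Nat.min_eq_left hb]
    · by_cases hq : (q r : ℕ) < S.buffer
      · have : min ((q r : ℕ) + 1) S.buffer = q r + 1 := by omega
        simp [ht, h0, this, Nat.cast_sub h0]
      · have : min ((q r : ℕ) + 1) S.buffer = q r := by omega
        simp [ht, this]
  · simp [ht]

theorem abs_busy_waiting_down (K : Fin M) (q : S.State) (r : Fin S.numServers) :
    |S.busy K (S.down q r) - S.busy K q| + |S.waiting K (S.down q r) - S.waiting K q| ≤ 1 := by
  have h1 := sum_update_sub (fun s k => if S.type s ≤ K ∧ 0 < k then (1 : ℝ) else 0) q r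
    ⟨(q r : ℕ) - 1, by omega⟩
  have h2 := sum_update_sub (fun s k => if S.type s ≤ K then ((k - 1 : ℕ) : ℝ) else 0) q r
    ⟨(q r : ℕ) - 1, by omega⟩
  unfold busy waiting down
  rw [h1, h2]
  by_cases ht : S.type r ≤ K
  · rcases Nat.lt_trichotomy (q r : ℕ) 1 with h | h | h
    · have h' : (q r : ℕ) = 0 := by omega
      simp [ht, h']
    · simp [ht, h]
    · have h' : (1 : ℕ) ≤ (q r : ℕ) - 1 := by omega
      have h3 : 0 < (q r : ℕ) := by omega
      simp [ht, h, h3, Nat.cast_sub h']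
  · simp [ht]

/-- The drift of half the squared excess of `waiting + softPos κ (busy - c)` over `L`. -/
theorem gen_excess_sq_le (hμ : ∀ m, 0 < μ m) (hb : 0 < S.buffer) (K : Fin M) {κ c L : ℝ}
    (hκ : 1 / 2 ≤ κ) (q : S.State) :
    S.gen μ P (fun q => (max (S.waiting K q + softPos κ (S.busy K q - c) - L) 0) ^ 2 / 2) q ≤
      max (S.waiting K q + softPos κ (S.busy K q - c) - L) 0 *
          (S.gen μ P (S.waiting K) q +
            softSlope κ (S.busy K q - c) * S.gen μ P (S.busy K) q) +
        (S.totalRate + ∑ r, μ (S.type r)) *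
          (max (S.waiting K q + softPos κ (S.busy K q - c) - L) 0 / (2 * κ) + 2) := by
  rw [← sum_joinRate (μ := μ) (P := P) q]
  set y := max (S.waiting K q + softPos κ (S.busy K q - c) - L) 0 with hy
  set E := y / (2 * κ) + 2 with hE
  have step : ∀ q', |S.busy K q' - S.busy K q| + |S.waiting K q' - S.waiting K q| ≤ 1 →
      (max (S.waiting K q' + softPos κ (S.busy K q' - c) - L) 0) ^ 2 / 2 - y ^ 2 / 2 ≤
        y * ((S.waiting K q' - S.waiting K q) +
          softSlope κ (S.busy K q - c) * (S.busy K q' - S.busy K q)) + E := by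
    intro q' hq'
    have h := excess_sq_sub_le (c := c) (L := L) (w := S.busy K q) (z := S.waiting K q) hκ hq'
    rwa [add_sub_cancel, add_sub_cancel] at h
  simp only [gen, mul_add, add_mul, Finset.mul_sum, Finset.sum_mul, ← Finset.sum_add_distrib]
  refine Finset.sum_le_sum fun r _ => ?_
  have h1 := mul_le_mul_of_nonneg_left (step _ (abs_busy_waiting_up hb K q r))
    (joinRate_nonneg (μ := μ) (P := P) q r)
  have h2 := mul_le_mul_of_nonneg_left (step _ (abs_busy_waiting_down K q r)) (hμ (S.type r)).le
  linarith

/-- The drift of the number of jobs at servers of types at most `K`. -/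
theorem gen_waiting_add_busy_le (K : Fin M) (q : S.State) :
    S.gen μ P (S.waiting K) q + S.gen μ P (S.busy K) q ≤
      S.totalRate - ∑ r, if S.type r ≤ K ∧ 0 < (q r : ℕ) then μ (S.type r) else 0 := by
  have h1 := gen_sum (S := S) (μ := μ) (P := P)
    (fun s k => if S.type s ≤ K ∧ 0 < k then (1 : ℝ) else 0) q
  have h2 := gen_sum (S := S) (μ := μ) (P := P)
    (fun s k => if S.type s ≤ K then ((k - 1 : ℕ) : ℝ) else 0) q
  unfold busy waiting
  rw [h1, h2, ← sum_joinRate (μ := μ) (P := P) q, ← Finset.sum_sub_distrib,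
    ← Finset.sum_add_distrib, ← Finset.sum_add_distrib, ← Finset.sum_add_distrib]
  refine Finset.sum_le_sum fun r _ => ?_
  have ha := joinRate_nonneg (μ := μ) (P := P) q r
  by_cases ht : S.type r ≤ K
  · rcases Nat.eq_zero_or_pos (q r : ℕ) with h0 | h0
    · simp [ht, h0]
      split_ifs <;> linarith
    · have h0' : (q r : ℕ) - 1 + 1 = q r := by omega
      rcases Nat.eq_or_lt_of_le (show 1 ≤ (q r : ℕ) from h0) with h3 | h3
      · simp [ht, ← h3]
        split_ifs <;> linarith
      · have h4 : (1 : ℕ) ≤ (q r : ℕ) - 1 := by omega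
        simp [ht, h0, h3, Nat.cast_sub h4, Nat.cast_sub h0]
        split_ifs <;> linarith
  · simp [ht, ha]

/-- A server of type at most `K` with a waiting job serves at rate at least `μ K` and holds at most
`b` waiting jobs, so that waiting jobs leave the queues at rate at least `μ K / b` each. -/
theorem gen_waiting_le (hb : 0 < S.buffer) (K : Fin M) (hμ : ∀ m, m ≤ K → μ K ≤ μ m)
    (hμK : 0 < μ K) (q : S.State) :
    S.gen μ P (S.waiting K) q ≤
      (∑ r, S.joinRate μ P q r * (if S.type r ≤ K ∧ (q r : ℕ) = 0 then 0 else 1)) -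
        μ K / S.buffer * S.waiting K q := by
  have h2 := gen_sum (S := S) (μ := μ) (P := P)
    (fun s k => if S.type s ≤ K then ((k - 1 : ℕ) : ℝ) else 0) q
  have hb' : (0 : ℝ) < S.buffer := by exact_mod_cast hb
  unfold waiting
  rw [h2, Finset.mul_sum, sub_eq_add_neg, ← Finset.sum_neg_distrib]
  refine add_le_add (Finset.sum_le_sum fun r _ => ?_) (Finset.sum_le_sum fun r _ => ?_)
  · refine mul_le_mul_of_nonneg_left ?_ (joinRate_nonneg q r)
    by_cases ht : S.type r ≤ K
    · rcases Nat.eq_zero_or_pos (q r : ℕ) with h0 | h0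
      · simp [ht, h0]
      · simp [ht, h0.ne', Nat.cast_sub h0]
        split_ifs <;> norm_num
    · simp [ht]
  · by_cases ht : S.type r ≤ K
    · rcases Nat.lt_or_ge 1 (q r : ℕ) with h1 | h1
      · have h4 : (1 : ℕ) ≤ (q r : ℕ) - 1 := by omega
        have h5 : 0 < (q r : ℕ) := by omega
        have h6 : (((q r : ℕ) - 1 : ℕ) : ℝ) ≤ S.buffer := by
          have := (q r).is_lt
          exact_mod_cast (by omega : (q r : ℕ) - 1 ≤ S.buffer)
        have h7 : μ K / S.buffer * (((q r : ℕ) - 1 : ℕ) : ℝ) ≤ μ K := by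
          rw [div_mul_eq_mul_div, div_le_iff₀ hb']
          exact mul_le_mul_of_nonneg_left h6 hμK.le
        have h8 := hμ _ ht
        rw [if_pos h5, if_pos ht, if_pos ht, Nat.cast_sub h4, Nat.cast_one]
        linarith
      · have h4 : (q r : ℕ) - 1 = 0 := by omega
        simp [h4]
    · simp [ht]

end System

end LoadBalancing

namespace LoadBalancing

namespace Regime

variable {M : ℕ} {S : System M} {μ α : Fin M → ℝ} {K : Fin M} {β ε : ℝ} {P : Policy}
  {p : S.State → ℝ}

open LoadBalancing.System

/-! ### Drift of the numbers of busy servers and waiting jobs -/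

theorem busy_eq (h : Regime S μ α K β ε) (q : S.State) :
    S.busy K q = S.numServers * ∑ m ∈ Finset.Iic K, α m -
      ((S.idleOf (fun m => m ≤ K) q).card : ℝ) := by
  have h1 := h.sum_type (Finset.Iic K) fun _ => 1
  simp only [Finset.mem_Iic, one_mul] at h1
  rw [card_idleOf, ← h1, busy, ← Finset.sum_sub_distrib]
  refine Finset.sum_congr rfl fun r _ => ?_
  by_cases ht : S.type r ≤ K
  · rcases Nat.eq_zero_or_pos (q r : ℕ) with h0 | h0
    · simp [ht, h0]
    · simp [ht, h0, h0.ne']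
  · simp [ht]

/-- The busy servers of types at most `K` work at least as fast as if all servers of types less
than `K` were busy, up to a correction for those that are idle. -/
theorem le_sum_rate_busy (h : Regime S μ α K β ε) (q : S.State) :
    S.totalRate + μ K * (S.busy K q - S.numServers * cStar μ α K S.normRate) -
        μ ⟨0, K.pos⟩ * S.idleFast K q ≤
      ∑ r, if S.type r ≤ K ∧ 0 < (q r : ℕ) then μ (S.type r) else 0 := by
  have h1 := h.sum_type (Finset.Iic K) μ
  simp only [Finset.mem_Iic] at h1
  have h2 := h.spare_capacity
  have h3 := h.busy_eq q
  have h4 : (∑ r, if S.type r ≤ K then μ (S.type r) else 0) -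
      μ K * ((S.idleOf (fun m => m ≤ K) q).card : ℝ) - μ ⟨0, K.pos⟩ * S.idleFast K q ≤
      ∑ r, if S.type r ≤ K ∧ 0 < (q r : ℕ) then μ (S.type r) else 0 := by
    rw [card_idleOf, idleFast, Finset.mul_sum, Finset.mul_sum, ← Finset.sum_sub_distrib,
      ← Finset.sum_sub_distrib]
    refine Finset.sum_le_sum fun r _ => ?_
    have hK := (h.rate_pos K).le
    have h5 := h.le_rate_zero (S.type r)
    have h6 := h.rate_pos (S.type r)
    rcases Nat.eq_zero_or_pos (q r : ℕ) with h0 | h0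
    · rcases lt_trichotomy (S.type r) K with ht | ht | ht
      · simp only [ht.le, ht, h0, and_self, if_true, lt_irrefl, and_false, if_false, mul_one]
        linarith
      · simp [ht, h0]
      · simp [ht.not_ge, ht.not_gt]
    · simp [h0, h0.ne']
  have h7 : S.numServers * ∑ m ∈ Finset.Iic K, μ m * α m = S.totalRate +
      μ K * (S.numServers * ∑ m ∈ Finset.Iic K, α m) -
      μ K * (S.numServers * cStar μ α K S.normRate) := by
    linarith
  rw [h1, h7] at h4
  refine le_trans (le_of_eq ?_) h4
  rw [h3]
  ring

/-- The rate of the arrivals that miss the idle servers of types at most `K`. -/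
theorem missing_idle_le (h : Regime S μ α K β ε) (q : S.State)
    (hq : S.numServers * (betaHat α K β / 2) ≤ ((S.idleOf (fun m => m ≤ K) q).card : ℝ)) :
    ∑ r, S.joinRate μ P q r * (if S.type r ≤ K ∧ (q r : ℕ) = 0 then 0 else 1) ≤
      S.numServers * (ε * μ K / (2 * (S.buffer : ℝ))) := by
  obtain ⟨d₁, d₂, -, hd₂, -, hD⟩ := h.connected
  refine (sum_joinRate_not_idleOf h.rate_anti (k := fun m => m ≤ K)
    (fun m m' h1 h2 => h1.trans h2) q).trans ?_
  refine (hD _ (fun r hr => (mem_idleOf.1 hr).1) hq).trans ?_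
  exact mul_le_mul_of_nonneg_left hd₂ h.numServers_pos.le

theorem missing_le_totalRate (q : S.State) :
    ∑ r, S.joinRate μ P q r * (if S.type r ≤ K ∧ (q r : ℕ) = 0 then 0 else 1) ≤ S.totalRate := by
  rw [← sum_joinRate (μ := μ) (P := P) q]
  refine Finset.sum_le_sum fun r _ => mul_le_of_le_one_right (joinRate_nonneg q r) ?_
  split_ifs <;> norm_num

/-- Powers of the buffer size up to the fifth are dominated by `ε ^ 2 * N`. -/
theorem pow_buffer_le (h : Regime S μ α K β ε) {k : ℕ} (hk : k ≤ 5) :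
    1152 * tau μ K * (S.buffer : ℝ) ^ k * Real.log S.numServers ≤ ε ^ 2 * S.numServers := by
  refine le_trans ?_ h.buffer_pow_le
  have := h.one_le_tau
  have := h.one_le_log
  have := pow_le_pow_right₀ (by linarith [h.six_le_buffer] : (1 : ℝ) ≤ S.buffer) hk
  gcongr

theorem pow_buffer_le' (h : Regime S μ α K β ε) {k : ℕ} (hk : k ≤ 5) :
    1152 * tau μ K * (S.buffer : ℝ) ^ k ≤ ε ^ 2 * S.numServers := by
  have h1 := h.one_le_tau
  exact le_trans (le_mul_of_one_le_right (by positivity) h.one_le_log) (h.pow_buffer_le hk)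

theorem sq_eps_le (h : Regime S μ α K β ε) : ε ^ 2 ≤ 1 := by
  have h1 := h.eps_le
  have h2 := h.eps_pos
  nlinarith

theorem buffer_le (h : Regime S μ α K β ε) : (S.buffer : ℝ) ≤ S.numServers := by
  have h1 := h.pow_buffer_le' (k := 1) (by norm_num)
  have h2 := mul_le_mul_of_nonneg_right h.sq_eps_le h.numServers_pos.le
  have h3 := mul_le_mul_of_nonneg_right h.one_le_tau (Nat.cast_nonneg (α := ℝ) S.buffer)
  have h4 := Nat.cast_nonneg (α := ℝ) S.buffer
  rw [pow_one] at h1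
  linarith

/-- The amount by which `waiting + (busy - N * C)⁺`, suitably smoothed, exceeds `N ε`. The smoothed
positive part bends while `busy` lies between `N * (C + ε / 4)` and `N * (C + ε / 2)`: there enough
servers are busy for the number of jobs to decrease, and, since `4 * ε ≤ β̂`, enough are idle for the
number of waiting jobs to decrease. -/
noncomputable def excess (S : System M) (μ α : Fin M → ℝ) (K : Fin M) (ε : ℝ) (q : S.State) : ℝ :=
  max (S.waiting K q + softPos (S.numServers * ε / 4)
    (S.busy K q - S.numServers * (cStar μ α K S.normRate + ε / 4)) - S.numServers * ε) 0

theorem excess_nonneg (q : S.State) : 0 ≤ excess S μ α K ε q := le_max_right _ _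

theorem waiting_add_busy (q : S.State) :
    S.waiting K q + S.busy K q = ∑ r, if S.type r ≤ K then ((q r : ℕ) : ℝ) else 0 := by
  rw [waiting, busy, ← Finset.sum_add_distrib]
  refine Finset.sum_congr rfl fun r _ => ?_
  by_cases ht : S.type r ≤ K
  · rcases Nat.eq_zero_or_pos (q r : ℕ) with h0 | h0
    · simp [ht, h0]
    · simp [ht, h0, Nat.cast_sub h0]
  · simp [ht]

theorem waiting_nonneg (q : S.State) : 0 ≤ S.waiting K q :=
  Finset.sum_nonneg fun r _ => by split_ifs <;> positivity

theorem busy_nonneg (q : S.State) : 0 ≤ S.busy K q :=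
  Finset.sum_nonneg fun r _ => by split_ifs <;> norm_num

theorem excess_le (h : Regime S μ α K β ε) (q : S.State) :
    excess S μ α K ε q ≤ S.buffer * S.numServers := by
  have hN := h.numServers_pos
  have hε := h.eps_pos
  have hC := h.cStar_nonneg
  have hκ : 0 < S.numServers * ε / 4 := by positivity
  have hW := busy_nonneg (K := K) q
  have h1 : S.waiting K q + S.busy K q ≤ S.buffer * S.numServers := by
    rw [waiting_add_busy]
    refine (Finset.sum_le_card_nsmul Finset.univ _ (S.buffer : ℝ) fun r _ => ?_).trans_eq ?_
    · split_ifs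
      · have := (q r).is_lt
        exact_mod_cast (by omega : (q r : ℕ) ≤ S.buffer)
      · positivity
    · simp [mul_comm]
  refine max_le ?_ (by positivity)
  set t := S.busy K q - S.numServers * (cStar μ α K S.normRate + ε / 4) with ht
  have h2 : softPos (S.numServers * ε / 4) t ≤ S.busy K q + S.numServers * ε / 4 / 2 := by
    have : 0 ≤ S.numServers * (cStar μ α K S.normRate + ε / 4) := by positivity
    rcases le_total t (S.numServers * ε / 4) with h3 | h3
    · linarith [softPos_le_half hκ h3]
    · linarith [softPos_le hκ (hκ.le.trans h3)]
  linarith [mul_pos hN hε]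

/-- While few fast servers are idle, the excess has a negative drift. Where the smoothed positive
part has positive slope, enough servers are busy for the number of jobs to decrease; where the
slope is less than one, enough servers of types at most `K` are idle for almost all arrivals to
join one, and the number of waiting jobs decreases. -/
theorem drift_excess (h : Regime S μ α K β ε) (q : S.State)
    (hX : S.idleFast K q < S.numServers * (ε / (3 * (S.buffer : ℝ) ^ 2)))
    (hy : 0 < excess S μ α K ε q) :
    S.gen μ P (S.waiting K) q + softSlope (S.numServers * ε / 4)
        (S.busy K q - S.numServers * (cStar μ α K S.normRate + ε / 4)) *
        S.gen μ P (S.busy K) q ≤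
      -(μ K * S.numServers * ε / (4 * S.buffer)) := by
  have hN := h.numServers_pos
  have hε := h.eps_pos
  have hb := h.six_le_buffer
  have hK := h.rate_pos K
  have hκ : 0 < S.numServers * ε / 4 := by positivity
  have hb0 : (0 : ℝ) < S.buffer := by linarith
  have hT := gen_waiting_add_busy_le (μ := μ) (P := P) K q
  have hwork := h.le_sum_rate_busy q
  have hgap := h.betaHat_le
  have h4ε := h.four_eps_le
  set C := cStar μ α K S.normRate with hC
  set t := S.busy K q - S.numServers * (C + ε / 4) with ht
  set s := softSlope (S.numServers * ε / 4) t with hs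
  have hs0 : 0 ≤ s := softSlope_nonneg hκ t
  have hs1 : s ≤ 1 := softSlope_le_one hκ t
  set ρ := μ K * S.numServers * ε / (4 * S.buffer) with hρ
  have hA : 0 < t → S.gen μ P (S.waiting K) q + S.gen μ P (S.busy K) q ≤ -ρ := by
    intro ht0
    have h1 : μ ⟨0, K.pos⟩ * S.idleFast K q ≤ μ K * S.numServers * ε / 108 := by
      have h2 := mul_le_mul_of_nonneg_left hX.le (h.rate_pos ⟨0, K.pos⟩).le
      refine h2.trans ?_
      rw [h.rate_zero_eq, mul_div_assoc', mul_div_assoc', div_le_div_iff₀ (by positivity)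
        (by norm_num)]
      have h3 := mul_le_mul_of_nonneg_left h.tau_le_sq_buffer
        (by positivity : 0 ≤ 3 * (μ K * S.numServers * ε))
      linarith
    have h2 : μ K * (S.numServers * ε / 4) ≤ μ K * (S.busy K q - S.numServers * C) :=
      mul_le_mul_of_nonneg_left (by linarith) hK.le
    have h3 : ρ ≤ μ K * S.numServers * ε / 24 :=
      div_le_div_of_nonneg_left (by positivity) (by norm_num) (by linarith)
    have h4 : 0 < μ K * S.numServers * ε := by positivity
    linarith
  have hB : t < S.numServers * ε / 4 → S.gen μ P (S.waiting K) q ≤ -ρ := by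
    intro htκ
    have h1 : S.numServers * (betaHat α K β / 2) ≤
        ((S.idleOf (fun m => m ≤ K) q).card : ℝ) := by
      have h2 := h.busy_eq q
      have h3 := mul_le_mul_of_nonneg_left hgap hN.le
      have h4 := mul_le_mul_of_nonneg_left h4ε hN.le
      have h5 := mul_pos hN hε
      linarith
    have h2 := h.missing_idle_le (P := P) q h1
    have h3 := gen_waiting_le (P := P) h.buffer_pos K
      (fun m hm => h.rate_anti.antitone hm) hK q
    have h4 := softPos_le_half hκ htκ.le
    have h5 : S.numServers * ε * (7 / 8) ≤ S.waiting K q := by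
      rw [excess, lt_max_iff] at hy
      rcases hy with hy | hy
      · linarith
      · exact absurd hy (lt_irrefl _)
    have h6 : μ K / S.buffer * (S.numServers * ε * (7 / 8)) ≤ μ K / S.buffer * S.waiting K q :=
      mul_le_mul_of_nonneg_left h5 (by positivity)
    have h7 : S.numServers * (ε * μ K / (2 * S.buffer)) -
        μ K / S.buffer * (S.numServers * ε * (7 / 8)) ≤ -ρ := by
      have h8 : S.numServers * (ε * μ K / (2 * S.buffer)) -
          μ K / S.buffer * (S.numServers * ε * (7 / 8)) = -(ρ * (3 / 2)) := by
        rw [hρ]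
        field_simp
        norm_num
      have : 0 < ρ := by positivity
      linarith
    linarith
  rcases le_or_gt t 0 with h0 | h0
  · rw [hs, softSlope_eq_zero hκ h0, zero_mul, add_zero]
    exact hB (by linarith)
  · rcases le_or_gt (S.numServers * ε / 4) t with h1 | h1
    · rw [hs, softSlope_eq_one hκ h1, one_mul]
      exact hA h0
    · have h2 := mul_le_mul_of_nonneg_left (hA h0) hs0
      have h3 := mul_le_mul_of_nonneg_left (hB h1) (sub_nonneg.2 hs1)
      linarith

/-- The mean excess is negligible compared with `N ε`. -/
theorem mean_excess_le (h : Regime S μ α K β ε) (hp : S.IsStationary μ P p) :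
    mean p (excess S μ α K ε) ≤ 48 * tau μ K * S.buffer / ε := by
  have hN := h.numServers_pos
  have hε := h.eps_pos
  have hb := h.six_le_buffer
  have hK := h.rate_pos K
  have hτ := h.one_le_tau
  have hb0 : (0 : ℝ) < S.buffer := by linarith
  have hμ₁ : 0 < μ ⟨0, K.pos⟩ := h.rate_pos _
  have hεN : 2 ≤ S.numServers * ε := by
    have h1 := h.pow_buffer_le' (k := 0) (by norm_num)
    rw [pow_zero, mul_one] at h1
    have h2 : ε ^ 2 * S.numServers ≤ S.numServers * ε := by
      rw [sq, mul_assoc, mul_comm (S.numServers : ℝ)]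
      exact mul_le_of_le_one_left (by positivity) (by linarith [h.eps_le])
    linarith
  have hκ : 1 / 2 ≤ S.numServers * ε / 4 := by linarith
  set ρ := μ K * S.numServers * ε / (4 * S.buffer) with hρ
  have hρ0 : 0 < ρ := by positivity
  have hρ1 : ρ ≤ S.numServers * μ ⟨0, K.pos⟩ := by
    rw [hρ, div_le_iff₀ (by positivity)]
    have h1 := h.le_rate_zero K
    have h2 : ε ≤ 4 * S.buffer := by linarith [h.eps_le]
    calc μ K * S.numServers * ε ≤ μ ⟨0, K.pos⟩ * S.numServers * (4 * S.buffer) := by gcongr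
      _ = _ := by ring
  have hρ2 : 4 * μ ⟨0, K.pos⟩ / ε ≤ ρ / 2 := by
    rw [hρ, h.rate_zero_eq, div_div, div_le_div_iff₀ hε (by positivity)]
    have h1 := h.pow_buffer_le' (k := 1) (by norm_num)
    rw [pow_one] at h1
    have h2 : 0 ≤ tau μ K * S.buffer := by positivity
    have h3 : 32 * (tau μ K * S.buffer) ≤ ε ^ 2 * S.numServers := by linarith
    linarith [mul_le_mul_of_nonneg_left h3 hK.le]
  have hgen : ∀ q, S.gen μ P (fun q => excess S μ α K ε q ^ 2 / 2) q ≤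
      (4 * S.numServers * μ ⟨0, K.pos⟩ - ρ / 2 * excess S μ α K ε q) +
        2 * (S.numServers : ℝ) ^ 2 * S.buffer * μ ⟨0, K.pos⟩ *
          (if S.numServers * (ε / (3 * (S.buffer : ℝ) ^ 2)) ≤ S.idleFast K q then 1 else 0) := by
    intro q
    have h1 := gen_excess_sq_le (P := P) h.rate_pos h.buffer_pos K hκ q
      (c := S.numServers * (cStar μ α K S.normRate + ε / 4)) (L := S.numServers * ε)
    have hy0 := excess_nonneg (μ := μ) (α := α) (K := K) (ε := ε) q
    have hyle := h.excess_le q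
    have hdr := h.drift_excess (P := P) q
    change S.gen μ P (fun q => excess S μ α K ε q ^ 2 / 2) q ≤ excess S μ α K ε q * _ +
      _ * (excess S μ α K ε q / _ + 2) at h1
    set y := excess S μ α K ε q with hy
    have hs0 := softSlope_nonneg (by linarith : 0 < S.numServers * ε / 4)
      (S.busy K q - S.numServers * (cStar μ α K S.normRate + ε / 4))
    have hs1 := softSlope_le_one (by linarith : 0 < S.numServers * ε / 4)
      (S.busy K q - S.numServers * (cStar μ α K S.normRate + ε / 4))
    set s := softSlope (S.numServers * ε / 4)
      (S.busy K q - S.numServers * (cStar μ α K S.normRate + ε / 4)) with hs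
    have herr : (S.totalRate + ∑ r, μ (S.type r)) * (y / (2 * (S.numServers * ε / 4)) + 2) ≤
        ρ / 2 * y + 4 * S.numServers * μ ⟨0, K.pos⟩ := by
      have h2 : S.totalRate + ∑ r, μ (S.type r) ≤ 2 * (S.numServers * μ ⟨0, K.pos⟩) := by
        linarith [h.totalRate_le, h.sum_rate_server_le]
      have h3 : 0 ≤ y / (2 * (S.numServers * ε / 4)) + 2 := by positivity
      refine (mul_le_mul_of_nonneg_right h2 h3).trans ?_
      have h4 : 2 * (S.numServers * μ ⟨0, K.pos⟩) * (y / (2 * (S.numServers * ε / 4)) + 2) =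
          4 * μ ⟨0, K.pos⟩ / ε * y + 4 * S.numServers * μ ⟨0, K.pos⟩ := by
        field_simp
        ring
      rw [h4]
      linarith [mul_le_mul_of_nonneg_right hρ2 hy0]
    by_cases hX : S.numServers * (ε / (3 * (S.buffer : ℝ) ^ 2)) ≤ S.idleFast K q
    · rw [if_pos hX, mul_one]
      have h2 := gen_waiting_add_busy_le (μ := μ) (P := P) K q
      have h3 : S.gen μ P (S.waiting K) q ≤ S.totalRate := by
        have h4 := gen_waiting_le (P := P) h.buffer_pos K
          (fun m hm => h.rate_anti.antitone hm) hK q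
        have h5 := missing_le_totalRate (μ := μ) (P := P) (K := K) q
        have h6 : 0 ≤ μ K / S.buffer * S.waiting K q :=
          mul_nonneg (by positivity) (waiting_nonneg q)
        linarith
      have h4 : 0 ≤ ∑ r, if S.type r ≤ K ∧ 0 < (q r : ℕ) then μ (S.type r) else 0 :=
        Finset.sum_nonneg fun r _ => by
          split_ifs
          · exact (h.rate_pos _).le
          · exact le_rfl
      have h5 : S.gen μ P (S.waiting K) q + s * S.gen μ P (S.busy K) q ≤
          S.numServers * μ ⟨0, K.pos⟩ := by
        have h6 : s * (S.gen μ P (S.waiting K) q + S.gen μ P (S.busy K) q) ≤ s * S.totalRate :=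
          mul_le_mul_of_nonneg_left (by linarith) hs0
        have h7 := mul_le_mul_of_nonneg_left h3 (sub_nonneg.2 hs1)
        linarith [h.totalRate_le]
      have h6 := mul_le_mul_of_nonneg_left h5 hy0
      have h7 := mul_le_mul_of_nonneg_right hρ1 hy0
      have h8 := mul_le_mul_of_nonneg_right hyle
        (by positivity : 0 ≤ 2 * (S.numServers * μ ⟨0, K.pos⟩))
      linarith
    · rw [if_neg hX, mul_zero, add_zero]
      rcases hy0.eq_or_lt with h0 | h0
      · rw [← h0] at h1 herr ⊢
        linarith
      · have h2 := mul_le_mul_of_nonneg_left (hdr (not_le.1 hX) h0) h0.le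
        linarith
  have hmean := mean_mono hp.1 hgen
  rw [mean_gen hp, mean_add, mean_sub, mean_const hp.2.1, mean_const_mul, mean_const_mul] at hmean
  have hprob := h.prob_idleFast_le hp
  set B := mean p (fun q => if S.numServers * (ε / (3 * (S.buffer : ℝ) ^ 2)) ≤ S.idleFast K q
      then (1 : ℝ) else 0) with hB
  have hN1 : (1 : ℝ) ≤ S.numServers := by linarith [h.buffer_le]
  have h1 : 2 * (S.numServers : ℝ) ^ 2 * S.buffer * μ ⟨0, K.pos⟩ * B ≤
      2 * S.numServers * μ ⟨0, K.pos⟩ := by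
    calc 2 * (S.numServers : ℝ) ^ 2 * S.buffer * μ ⟨0, K.pos⟩ * B
        ≤ 2 * (S.numServers : ℝ) ^ 2 * S.numServers * μ ⟨0, K.pos⟩ *
          ((S.numServers : ℝ) ^ 3)⁻¹ := by
          gcongr
          · exact mean_nonneg hp.1 fun q => by split_ifs <;> norm_num
          · exact_mod_cast h.buffer_le
      _ = 2 * 1 * μ ⟨0, K.pos⟩ := by
          field_simp
      _ ≤ _ := by gcongr
  rw [le_div_iff₀ hε]
  have h2 : ρ / 2 * mean p (excess S μ α K ε) ≤ 6 * S.numServers * μ ⟨0, K.pos⟩ := by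
    have : mean p (fun q => excess S μ α K ε q) = mean p (excess S μ α K ε) := rfl
    linarith
  have h3 : ρ / 2 * mean p (excess S μ α K ε) =
      μ K * S.numServers / (8 * S.buffer) * (mean p (excess S μ α K ε) * ε) := by
    rw [hρ]
    field_simp
    ring
  rw [h3, h.rate_zero_eq, div_mul_eq_mul_div, div_le_iff₀ (by positivity)] at h2
  refine le_of_mul_le_mul_left ?_ (mul_pos hK hN)
  linarith

end Regime

end LoadBalancing

namespace LoadBalancing

namespace Regime

variable {M : ℕ} {S : System M} {μ α : Fin M → ℝ} {K : Fin M} {β ε : ℝ} {P : Policy}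
  {p : S.State → ℝ}

open LoadBalancing.System

/-! ### Error bounds for one system -/

/-- With probability close to one, a fraction of at least `β̂ / 2` of the servers is idle and of
type at most `K`. -/
theorem prob_few_idle_le (h : Regime S μ α K β ε) (hp : S.IsStationary μ P p) :
    S.buffer * mean p (fun q => if ((S.idleOf (fun m => m ≤ K) q).card : ℝ) <
      S.numServers * (betaHat α K β / 2) then 1 else 0) ≤ 1 / Real.log S.numServers := by
  have hN := h.numServers_pos
  have hε := h.eps_pos
  have hlog := h.one_le_log
  have hκ : 0 < S.numServers * ε / 4 := by positivity
  have hE := h.mean_excess_le hp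
  have hle : S.numServers * ε / 2 * mean p (fun q =>
      if ((S.idleOf (fun m => m ≤ K) q).card : ℝ) < S.numServers * (betaHat α K β / 2)
      then 1 else 0) ≤ mean p (excess S μ α K ε) := by
    rw [← mean_const_mul]
    refine mean_mono hp.1 fun q => ?_
    split_ifs with hq
    · have h1 := h.busy_eq q
      have h2 := mul_le_mul_of_nonneg_left h.betaHat_le hN.le
      have h3 := mul_le_mul_of_nonneg_left h.four_eps_le hN.le
      have h4 := sub_half_le_softPos hκ
        (S.busy K q - S.numServers * (cStar μ α K S.normRate + ε / 4))
      have h5 := waiting_nonneg (K := K) q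
      have h6 := mul_pos hN hε
      exact le_max_of_le_left (by linarith)
    · rw [mul_zero]
      exact excess_nonneg q
  set B := mean p (fun q => if ((S.idleOf (fun m => m ≤ K) q).card : ℝ) <
      S.numServers * (betaHat α K β / 2) then (1 : ℝ) else 0) with hB
  have h1 := hle.trans hE
  rw [le_div_iff₀ hε] at h1
  have h2 := h.pow_buffer_le (k := 2) (by norm_num)
  have hτ := h.one_le_tau
  have hb := h.six_le_buffer
  rw [le_div_iff₀ (by linarith)]
  have hpos : 0 < ε ^ 2 * S.numServers := by positivity
  refine le_of_mul_le_mul_left ?_ hpos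
  have h3 : ε ^ 2 * S.numServers * B ≤ 96 * tau μ K * S.buffer := by linarith
  have h4 : 0 ≤ S.buffer * Real.log S.numServers := by positivity
  have h5 := mul_le_mul_of_nonneg_right h3 h4
  have h6 : 0 ≤ tau μ K * (S.buffer : ℝ) ^ 2 * Real.log S.numServers := by positivity
  linarith

/-- The rate of the arrivals that miss the idle servers of types at most `K`, even multiplied by
the buffer size, is negligible compared with `N`. -/
theorem mean_missing_le (h : Regime S μ α K β ε) (hp : S.IsStationary μ P p) :
    S.buffer * mean p (fun q =>
      ∑ r, S.joinRate μ P q r * (if S.type r ≤ K ∧ (q r : ℕ) = 0 then 0 else 1)) ≤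
      S.numServers * (ε * μ K + μ ⟨0, K.pos⟩ / Real.log S.numServers) := by
  have hN := h.numServers_pos
  have hε := h.eps_pos
  have hb := h.six_le_buffer
  have hK := h.rate_pos K
  have hμ₁ := h.rate_pos ⟨0, K.pos⟩
  have h1 := h.prob_few_idle_le hp
  have h2 : mean p (fun q =>
      ∑ r, S.joinRate μ P q r * (if S.type r ≤ K ∧ (q r : ℕ) = 0 then 0 else 1)) ≤
      S.numServers * (ε * μ K / (2 * S.buffer)) + S.numServers * μ ⟨0, K.pos⟩ *
      mean p (fun q => if ((S.idleOf (fun m => m ≤ K) q).card : ℝ) <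
        S.numServers * (betaHat α K β / 2) then 1 else 0) := by
    rw [← mean_const hp.2.1 (S.numServers * (ε * μ K / (2 * S.buffer))), ← mean_const_mul,
      ← mean_add]
    refine mean_mono hp.1 fun q => ?_
    split_ifs with hq
    · have h3 := missing_le_totalRate (μ := μ) (P := P) (K := K) q
      have h4 : 0 ≤ S.numServers * (ε * μ K / (2 * S.buffer)) := by positivity
      linarith [h.totalRate_le]
    · rw [mul_zero, add_zero]
      exact h.missing_idle_le q (not_lt.1 hq)
  have h3 := mul_le_mul_of_nonneg_left h2 (by linarith : (0 : ℝ) ≤ S.buffer)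
  have h4 := mul_le_mul_of_nonneg_left h1 (by positivity : 0 ≤ S.numServers * μ ⟨0, K.pos⟩)
  have h5 : S.buffer * (S.numServers * (ε * μ K / (2 * S.buffer))) =
      S.numServers * (ε * μ K) / 2 := by
    field_simp
  have h6 : 0 < S.numServers * (ε * μ K) := by positivity
  rw [mul_add, h5] at h3
  rw [mul_one_div] at h4
  rw [mul_add, mul_div_assoc']
  linarith

/-- The number of busy servers. -/
noncomputable def busyAll (S : System M) (q : S.State) : ℝ :=
  ∑ r, if 0 < (q r : ℕ) then 1 else 0

theorem totalRate_sub_mean_admission_le (h : Regime S μ α K β ε) (hp : S.IsStationary μ P p) :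
    S.totalRate - mean p (S.admission μ P) ≤
      S.numServers * (ε * μ K + μ ⟨0, K.pos⟩ / Real.log S.numServers) := by
  have h1 := h.mean_missing_le hp
  have h2 : S.totalRate - mean p (S.admission μ P) ≤ mean p (fun q =>
      ∑ r, S.joinRate μ P q r * (if S.type r ≤ K ∧ (q r : ℕ) = 0 then 0 else 1)) := by
    rw [← mean_const hp.2.1 S.totalRate, ← mean_sub]
    refine mean_mono hp.1 fun q => ?_
    rw [totalRate_sub_admission]
    refine Finset.sum_le_sum fun r _ => ?_
    have hb := h.buffer_pos
    have ha := joinRate_nonneg (μ := μ) (P := P) q r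
    split_ifs with h3 h4
    · omega
    · rw [mul_one]
    · rw [mul_zero]
    · rw [mul_one]
      exact ha
  refine le_trans (h2.trans ?_) h1
  refine le_mul_of_one_le_left (mean_nonneg hp.1 fun q => Finset.sum_nonneg fun r _ =>
    mul_nonneg (joinRate_nonneg q r) ?_) (by linarith [h.six_le_buffer])
  split_ifs <;> norm_num

theorem mean_admission_le (hp : S.IsStationary μ P p) :
    mean p (S.admission μ P) ≤ S.totalRate := by
  rw [← mean_const hp.2.1 S.totalRate]
  refine mean_mono hp.1 fun q => ?_
  rw [← sub_nonneg, totalRate_sub_admission]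
  refine Finset.sum_nonneg fun r _ => ?_
  split_ifs
  · exact joinRate_nonneg q r
  · exact le_rfl

/-- In steady state few jobs are at servers of types greater than `K`. -/
theorem mean_slow_le (h : Regime S μ α K β ε) (hp : S.IsStationary μ P p) {ν : ℝ}
    (hνμ : ∀ m, ν ≤ μ m) :
    ν * mean p (fun q => ∑ r, if S.type r ≤ K then 0 else ((q r : ℕ) : ℝ)) ≤
      S.numServers * (ε * μ K + μ ⟨0, K.pos⟩ / Real.log S.numServers) := by
  refine le_trans ?_ (h.mean_missing_le hp)
  rw [← mean_const_mul, ← mean_const_mul, ← sub_nonneg, ← mean_sub]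
  have hb := h.six_le_buffer
  have hgen : mean p (fun q => S.buffer * S.gen μ P
      (fun q => ∑ r, if S.type r ≤ K then 0 else ((q r : ℕ) : ℝ)) q) = 0 := by
    rw [mean_const_mul, mean_gen hp, mul_zero]
  refine hgen.symm.trans_le (mean_mono hp.1 fun q => ?_)
  rw [gen_sum (fun r k => if S.type r ≤ K then 0 else (k : ℝ)), mul_add, Finset.mul_sum,
    Finset.mul_sum, Finset.mul_sum, Finset.mul_sum, ← Finset.sum_add_distrib,
    ← Finset.sum_sub_distrib]
  refine Finset.sum_le_sum fun r _ => ?_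
  have ha := mul_nonneg (Nat.cast_nonneg (α := ℝ) S.buffer)
    (joinRate_nonneg (μ := μ) (P := P) q r)
  by_cases ht : S.type r ≤ K
  · simp only [ht, if_true, sub_zero, mul_zero, ite_self, add_zero, true_and]
    split_ifs <;> linarith
  · have h1 : ((q r : ℕ) : ℝ) ≤ S.buffer := by
      have := (q r).is_lt
      exact_mod_cast (by omega : (q r : ℕ) ≤ S.buffer)
    have h2 : ν * ((q r : ℕ) : ℝ) ≤ S.buffer * μ (S.type r) := by
      rw [mul_comm (S.buffer : ℝ)]
      exact mul_le_mul (hνμ _) h1 (Nat.cast_nonneg _) (h.rate_pos _).le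
    rcases Nat.eq_zero_or_pos (q r : ℕ) with h0 | h0
    · simp only [ht, h0, if_false, false_and, lt_irrefl, Nat.cast_zero, mul_zero]
      split_ifs <;> push_cast <;> linarith
    · simp only [ht, h0, if_false, if_true, false_and, Nat.cast_sub (show 1 ≤ (q r : ℕ) from h0)]
      split_ifs <;> push_cast <;> linarith

/-- The number of busy servers is at least the cheapest way to provide the admitted work. -/
theorem le_mean_busyAll (h : Regime S μ α K β ε) (hp : S.IsStationary μ P p) :
    S.numServers * cStar μ α K S.normRate -
        (S.totalRate - mean p (S.admission μ P)) / μ K ≤ mean p (busyAll S) := by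
  have hK := h.rate_pos K
  have hN := h.numServers_pos
  have h1 := h.sum_type (Finset.Iio K) fun m => 1 - μ m / μ K
  simp only [Finset.mem_Iio] at h1
  have h2 : ∀ q : S.State, (∑ r, if S.type r < K then (1 - μ (S.type r) / μ K) else 0) ≤
      busyAll S q - (1 / μ K) * ∑ r, if 0 < (q r : ℕ) then μ (S.type r) else 0 := by
    intro q
    rw [busyAll, Finset.mul_sum, ← Finset.sum_sub_distrib]
    refine Finset.sum_le_sum fun r _ => ?_
    by_cases ht : S.type r < K
    · have h3 : 1 ≤ μ (S.type r) / μ K := (one_le_div hK).2 (h.rate_anti ht).le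
      rw [if_pos ht]
      split_ifs
      · rw [one_div_mul_eq_div]
      · linarith
    · have h3 : μ (S.type r) / μ K ≤ 1 :=
        (div_le_one hK).2 (h.rate_anti.antitone (not_lt.1 ht))
      rw [if_neg ht]
      split_ifs
      · rw [one_div_mul_eq_div]
        linarith
      · simp
  have h3 := mean_mono hp.1 h2
  rw [mean_const hp.2.1, mean_sub, mean_const_mul, ← mean_admission hp, h1] at h3
  refine le_trans (le_of_eq ?_) (le_sub_iff_add_le.1 h3)
  have h4 : ∑ m ∈ Finset.Iio K, (1 - μ m / μ K) * α m =
      ∑ m ∈ Finset.Iio K, α m - (∑ m ∈ Finset.Iio K, μ m * α m) / μ K := by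
    rw [Finset.sum_div, ← Finset.sum_sub_distrib]
    exact Finset.sum_congr rfl fun m _ => by ring
  rw [h4, cStar, normRate]
  field_simp
  ring

theorem mean_fast_le (h : Regime S μ α K β ε) (hp : S.IsStationary μ P p) :
    mean p (fun q => ∑ r, if S.type r ≤ K then ((q r : ℕ) : ℝ) else 0) ≤
      S.numServers * (cStar μ α K S.normRate + 3 * ε) := by
  have hN := h.numServers_pos
  have hε := h.eps_pos
  have hκ : 0 < S.numServers * ε / 4 := by positivity
  have h1 := h.mean_excess_le hp
  have h2 : 48 * tau μ K * S.buffer / ε ≤ S.numServers * ε / 2 := by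
    rw [div_le_iff₀ hε]
    have h3 := h.pow_buffer_le' (k := 1) (by norm_num)
    have h4 : 0 ≤ tau μ K * S.buffer :=
      mul_nonneg (by linarith [h.one_le_tau]) (Nat.cast_nonneg _)
    rw [pow_one] at h3
    linarith
  have h3 : mean p (fun q => ∑ r, if S.type r ≤ K then ((q r : ℕ) : ℝ) else 0) ≤
      mean p (excess S μ α K ε) + S.numServers * (cStar μ α K S.normRate + 11 / 8 * ε) := by
    rw [← mean_const hp.2.1 (S.numServers * (cStar μ α K S.normRate + 11 / 8 * ε)), ← mean_add]
    refine mean_mono hp.1 fun q => ?_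
    rw [← waiting_add_busy]
    have h4 := sub_half_le_softPos hκ
      (S.busy K q - S.numServers * (cStar μ α K S.normRate + ε / 4))
    have h5 : S.waiting K q + softPos (S.numServers * ε / 4)
        (S.busy K q - S.numServers * (cStar μ α K S.normRate + ε / 4)) - S.numServers * ε ≤
        excess S μ α K ε q := le_max_left _ _
    linarith
  have := mul_pos hN hε
  linarith

theorem mean_total_eq :
    mean p (fun q => ∑ r, ((q r : ℕ) : ℝ)) =
      mean p (busyAll S) + mean p (fun q => ∑ r, (((q r : ℕ) - 1 : ℕ) : ℝ)) := by
  rw [← mean_add]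
  congr 1
  funext q
  rw [busyAll, ← Finset.sum_add_distrib]
  refine Finset.sum_congr rfl fun r _ => ?_
  rcases Nat.eq_zero_or_pos (q r : ℕ) with h0 | h0
  · simp [h0]
  · simp [h0, Nat.cast_sub h0]

/-- The error bounds for one system: with a common error `δ` that vanishes along the sequence, the
normalized mean number of jobs is `C^*`, the normalized mean number of waiting jobs is zero, and
the normalized rate of admission is `λ`. -/
theorem error_bounds (h : Regime S μ α K β ε) (hp : S.IsStationary μ P p) {ν : ℝ} (hν : 0 < ν)
    (hνμ : ∀ m, ν ≤ μ m) {δ : ℝ}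
    (hδ : δ = 3 * ε + (ε * μ K + μ ⟨0, K.pos⟩ / Real.log S.numServers) *
      (1 / ν + 1 / μ K + 1)) :
    |mean p (fun q => ∑ r, ((q r : ℕ) : ℝ)) / S.numServers - cStar μ α K S.normRate| ≤ δ ∧
      mean p (fun q => ∑ r, (((q r : ℕ) - 1 : ℕ) : ℝ)) / S.numServers ≤ δ ∧
      S.normRate - mean p (S.admission μ P) / S.numServers ≤ δ := by
  have hN := h.numServers_pos
  have hε := h.eps_pos
  have hK := h.rate_pos K
  have hμ₁ := h.rate_pos ⟨0, K.pos⟩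
  have hlog := h.one_le_log
  have h1 := h.mean_fast_le hp
  have h2 := h.mean_slow_le hp hνμ
  have h3 := h.totalRate_sub_mean_admission_le hp
  have h4 := h.le_mean_busyAll hp
  have h5 := mean_total_eq (S := S) (p := p)
  have h6 : mean p (fun q => ∑ r, ((q r : ℕ) : ℝ)) =
      mean p (fun q => ∑ r, if S.type r ≤ K then ((q r : ℕ) : ℝ) else 0) +
        mean p (fun q => ∑ r, if S.type r ≤ K then 0 else ((q r : ℕ) : ℝ)) := by
    rw [← mean_add]
    congr 1
    funext q
    rw [← Finset.sum_add_distrib]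
    exact Finset.sum_congr rfl fun r _ => by split_ifs <;> simp
  have h7 : 0 ≤ mean p (fun q => ∑ r, (((q r : ℕ) - 1 : ℕ) : ℝ)) :=
    mean_nonneg hp.1 fun q => Finset.sum_nonneg fun r _ => Nat.cast_nonneg _
  set ρ := ε * μ K + μ ⟨0, K.pos⟩ / Real.log S.numServers with hρ
  set T := mean p (fun q => ∑ r, ((q r : ℕ) : ℝ)) with hT
  set D := mean p (fun q => ∑ r, (((q r : ℕ) - 1 : ℕ) : ℝ)) with hD
  set C := cStar μ α K S.normRate with hC
  have hρ0 : 0 ≤ ρ := by positivity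
  rw [mul_comm ν, ← le_div_iff₀ hν] at h2
  have h8 : (S.totalRate - mean p (S.admission μ P)) / μ K ≤ S.numServers * ρ / μ K :=
    div_le_div_of_nonneg_right h3 hK.le
  have e1 : S.numServers * ρ / ν = S.numServers * (ρ * (1 / ν)) := by ring
  have e2 : S.numServers * ρ / μ K = S.numServers * (ρ * (1 / μ K)) := by ring
  have p1 : 0 ≤ S.numServers * (ρ * (1 / ν)) := by positivity
  have p2 : 0 ≤ S.numServers * (ρ * (1 / μ K)) := by positivity
  have p3 : 0 ≤ S.numServers * ρ := by positivity
  have p4 : 0 < S.numServers * ε := by positivity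
  have e3 : δ * S.numServers = 3 * (S.numServers * ε) + S.numServers * (ρ * (1 / ν)) +
      S.numServers * (ρ * (1 / μ K)) + S.numServers * ρ := by
    rw [hδ]
    ring
  refine ⟨?_, ?_, ?_⟩
  · rw [abs_le, le_sub_iff_add_le, sub_le_iff_le_add, le_div_iff₀ hN, div_le_iff₀ hN]
    constructor <;> linarith
  · rw [div_le_iff₀ hN]
    linarith
  · rw [normRate, ← sub_div, div_le_iff₀ hN]
    linarith

end Regime

end LoadBalancing

namespace LoadBalancing

namespace Regime

variable {M : ℕ} {S : System M} {μ α : Fin M → ℝ} {K : Fin M} {β ε : ℝ} {P : Policy}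
  {p : S.State → ℝ}

/-! ### The limits -/

theorem performance_bounds (h : Regime S μ α K β ε) (hp : S.IsStationary μ P p) {ν c : ℝ}
    (hν : 0 < ν) (hνμ : ∀ m, ν ≤ μ m) (hc : 0 < c) (hcl : c ≤ S.normRate) {δ : ℝ}
    (hδ : δ = 3 * ε + (ε * μ K + μ ⟨0, K.pos⟩ / Real.log S.numServers) *
      (1 / ν + 1 / μ K + 1)) (hδc : δ ≤ c / 2) :
    |S.meanResponse μ P p - cStar μ α K S.normRate / S.normRate| ≤
        δ * ((μ ⟨0, K.pos⟩ + 1) / (c / 2 * c)) ∧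
      |S.blockingProb μ P p| ≤ δ * (1 / c) ∧ |S.meanDelay μ P p| ≤ δ * (1 / (c / 2)) := by
  obtain ⟨h1, h2, h3⟩ := h.error_bounds hp hν hνμ hδ
  have hN := h.numServers_pos
  have hA := mean_admission_le hp
  have hΛ : S.totalRate = S.normRate * S.numServers := by
    rw [System.normRate, div_mul_cancel₀ _ hN.ne']
  have hlμ : S.normRate ≤ μ ⟨0, K.pos⟩ := by
    rw [System.normRate, div_le_iff₀ hN, mul_comm]
    exact h.totalRate_le
  rw [System.meanResponse_eq h.rate_pos hp, System.meanDelay_eq h.rate_pos hp,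
    System.blockingProb_eq hp (by rw [hΛ]; exact mul_pos (hc.trans_le hcl) hN), hΛ]
  have h0 : 0 ≤ mean p (fun q : S.State => ∑ r, (((q r : ℕ) - 1 : ℕ) : ℝ)) :=
    mean_nonneg hp.1 fun q => Finset.sum_nonneg fun r _ => Nat.cast_nonneg _
  have hC0 := h.cStar_nonneg
  have hC1 := h.cStar_le_one
  rw [← div_div_div_cancel_right₀ hN.ne' (mean p fun q => ∑ r, ((q r : ℕ) : ℝ)),
    ← div_div_div_cancel_right₀ hN.ne' (mean p fun q => ∑ r, (((q r : ℕ) - 1 : ℕ) : ℝ)),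
    mul_comm S.normRate, ← div_div (mean p (S.admission μ P))]
  set D := mean p (fun q : S.State => ∑ r, (((q r : ℕ) - 1 : ℕ) : ℝ)) / S.numServers with hD
  set T := mean p (fun q : S.State => ∑ r, ((q r : ℕ) : ℝ)) / S.numServers with hT
  have hAN : mean p (S.admission μ P) / S.numServers ≤ S.normRate := by
    rw [div_le_iff₀ hN, ← hΛ]
    exact hA
  set A := mean p (S.admission μ P) / S.numServers with hAdef
  set C := cStar μ α K S.normRate with hC
  have hl : 0 < S.normRate := hc.trans_le hcl
  have hD0 : 0 ≤ D := div_nonneg h0 hN.le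
  have hδ0 : 0 ≤ δ := hD0.trans h2
  have hA0 : c / 2 ≤ A := by linarith
  have hA1 : 0 < A := by linarith
  refine ⟨?_, ?_, ?_⟩
  · rw [div_sub_div _ _ hA1.ne' hl.ne', abs_div, abs_of_pos (mul_pos hA1 hl), mul_div_assoc']
    refine div_le_div₀ (by have := h.rate_pos ⟨0, K.pos⟩; positivity) ?_ (by positivity)
      (mul_le_mul hA0 hcl hc.le hA1.le)
    have e : T * S.normRate - A * C = (T - C) * S.normRate + C * (S.normRate - A) := by ring
    rw [e]
    refine (abs_add_le _ _).trans ?_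
    rw [abs_mul, abs_mul, abs_of_pos hl, abs_of_nonneg hC0, abs_of_nonneg (sub_nonneg.2 hAN)]
    have b1 : |T - C| * S.normRate ≤ δ * μ ⟨0, K.pos⟩ := mul_le_mul h1 hlμ hl.le hδ0
    have b2 : C * (S.normRate - A) ≤ 1 * δ :=
      mul_le_mul hC1 h3 (sub_nonneg.2 hAN) zero_le_one
    linarith
  · have e : 1 - A / S.normRate = (S.normRate - A) / S.normRate := by
      rw [sub_div, div_self hl.ne']
    rw [e, abs_of_nonneg (div_nonneg (sub_nonneg.2 hAN) hl.le), mul_one_div]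
    exact div_le_div₀ hδ0 h3 hc hcl
  · rw [abs_of_nonneg (div_nonneg hD0 hA1.le), mul_one_div]
    exact div_le_div₀ hδ0 h2 (by positivity) hA0

end Regime

end LoadBalancing

theorem corollary1 {M : ℕ} (μ α : Fin M → ℝ) (K : Fin M)
    (hμ : ∀ m, 0 < μ m) (hμ_anti : StrictAnti μ)
    (hα : ∀ m, 0 < α m) (hα_sum : ∑ m, α m = 1)
    (G : ℕ → LoadBalancing.System M) (β ε : ℕ → ℝ)
    (hN : Filter.Tendsto (fun n => (G n).numServers) Filter.atTop Filter.atTop)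
    (htype : ∀ n m, ((Finset.univ.filter fun r => (G n).type r = m).card : ℝ) =
      (G n).numServers * α m)
    (hK : ∀ n, LoadBalancing.IsCritical (G n) μ α K)
    (hβ : ∀ n, (G n).totalRate =
      (G n).numServers * (∑ m ∈ Finset.Iic K, μ m * α m) * (1 - β n))
    (hload : ∃ c : ℝ, 0 < c ∧ ∀ᶠ n in Filter.atTop, c ≤ (G n).normRate)
    (hε_zero : Filter.Tendsto ε Filter.atTop (nhds 0))
    (hε_omega : Filter.Tendsto
      (fun n => ε n / (Real.log (G n).numServers * ((G n).numServers : ℝ) ^ (-(1 / 2) : ℝ)))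
      Filter.atTop Filter.atTop)
    (hbuffer : ∀ᶠ n in Filter.atTop,
      LoadBalancing.BufferAssumption (G n) μ α K (β n) (ε n))
    (hconn : ∀ᶠ n in Filter.atTop,
      LoadBalancing.WellConnected (G n) μ α K (β n) (ε n)) :
    ∀ P : LoadBalancing.Policy,
      LoadBalancing.AsymptoticallyOptimal G μ α K P ∧
      ∀ p : (n : ℕ) → (G n).State → ℝ, (∀ n, (G n).IsStationary μ P (p n)) →
        Filter.Tendsto (fun n => (G n).meanDelay μ P (p n)) Filter.atTop (nhds 0) := by
  intro P
  obtain ⟨c, hc, hcl⟩ := hload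
  have hlog : Tendsto (fun n => Real.log (G n).numServers) atTop atTop :=
    Real.tendsto_log_atTop.comp (tendsto_natCast_atTop_atTop.comp hN)
  obtain ⟨m₀, -, hm₀⟩ := Finset.exists_min_image Finset.univ μ ⟨K, Finset.mem_univ K⟩
  have hνμ : ∀ m, μ m₀ ≤ μ m := fun m => hm₀ m (Finset.mem_univ m)
  set δ : ℕ → ℝ := fun n => 3 * ε n + (ε n * μ K + μ ⟨0, K.pos⟩ / Real.log (G n).numServers) *
    (1 / μ m₀ + 1 / μ K + 1) with hδ
  have hδ0 : Tendsto δ atTop (𝓝 0) := by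
    have h1 := hlog.const_div_atTop (μ ⟨0, K.pos⟩)
    have h2 := (hε_zero.const_mul 3).add
      (((hε_zero.mul_const (μ K)).add h1).mul_const (1 / μ m₀ + 1 / μ K + 1))
    simpa [hδ] using h2
  have hregime : ∀ᶠ n in atTop, LoadBalancing.Regime (G n) μ α K (β n) (ε n) := by
    filter_upwards [hbuffer, hconn, hlog.eventually_ge_atTop 1] with n h1 h2 h3
    exact ⟨hμ, hμ_anti, hα, hα_sum, htype n, hK n, hβ n, h1, h2, h3⟩
  have hδc := hδ0.eventually_le_const (by positivity : (0 : ℝ) < c / 2)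
  have hbounds : ∀ p : (n : ℕ) → (G n).State → ℝ, (∀ n, (G n).IsStationary μ P (p n)) →
      ∀ᶠ n in atTop,
        |(G n).meanResponse μ P (p n) -
            LoadBalancing.cStar μ α K (G n).normRate / (G n).normRate| ≤
          δ n * ((μ ⟨0, K.pos⟩ + 1) / (c / 2 * c)) ∧
        |(G n).blockingProb μ P (p n)| ≤ δ n * (1 / c) ∧
        |(G n).meanDelay μ P (p n)| ≤ δ n * (1 / (c / 2)) := by
    intro p hp
    filter_upwards [hregime, hcl, hδc] with n h1 h2 h3
    exact h1.performance_bounds (hp n) (hμ m₀) hνμ hc h2 rfl h3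
  have hlim : ∀ (f : ℕ → ℝ) (a : ℝ), (∀ᶠ n in atTop, |f n| ≤ δ n * a) →
      Tendsto f atTop (𝓝 0) := by
    intro f a hf
    refine squeeze_zero_norm' hf ?_
    simpa using hδ0.mul_const a
  refine ⟨⟨fun n => LoadBalancing.System.existsUnique_isStationary hμ, fun p hp => ⟨?_, ?_⟩⟩,
    fun p hp => ?_⟩
  · exact hlim _ _ ((hbounds p hp).mono fun n h => h.1)
  · exact hlim _ _ ((hbounds p hp).mono fun n h => h.2.1)
  · exact hlim _ _ ((hbounds p hp).mono fun n h => h.2.2)
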